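/- Let $\Sigma=\{0,1\}$. A promise problem is a function $\phi$ that assigns to every string over $\Sigma$ a non-empty set $\phi(x)\subseteq\Sigma$ of valid answers. For promise problems $\phi_1,\phi_2$ write $\phi_1\propto_T\phi_2$ if there are an oracle Turing machine $M$ and a polynomial $p$ such that, for every input $x$, every possible path of $M$ halts after at most $p(|x|)$ steps with output some $y\in\phi_1(x)$, where an oracle call with query $q$ takes one step and may return any element of $\phi_2(q)$ (chosen adversarially, and independently for different calls). Let $\widehat{\mathrm P}^{\phi}=\{\psi\mid\psi\propto_T\phi\}$. For $n\ge 1$ let $f:\Sigma^{m_1}\times\cdots\times\Sigma^{m_n}\to\Sigma$ (with $m_1\ge 1$) be given by the lengths $m_1,\dots,m_n$ and a boolean expression. Write $f_x$ for $f$ with its first argument fixed to $x\in\Sigma^{m_1}$, and let $$S_f=\{x\in\Sigma^{m_1}\mid \forall y^{(1)}\,\exists y^{(2)}\,\forall y^{(3)}\cdots\; f_x(y^{(1)},\dots,y^{(n-1)})=1\}$$ (with $n-1$ alternating quantifiers, $y^{(i)}\in\Sigma^{m_{i+1}}$). The promise problem $\mathrm{USAT}_n$ asks, under the promise $|S_f|\le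 1$, whether $S_f\neq\emptyset$ (answer $1$ if so, $0$ if not). The promise problem $\mathrm{UVAL}_n$ asks, under the promise $|S_f|=1$, for the first bit of the unique element of $S_f$. When the promise fails, or the input does not encode such an $f$, both answers are valid. Theorem. For every $n\ge 1$, $$\widehat{\mathrm P}^{\mathrm{UVAL}_n}=\widehat{\mathrm P}^{\mathrm{USAT}_n}.$$ In other words, let $\mathrm U\widehat\Delta_{n+1}:=\widehat{\mathrm P}^{\mathrm{USAT}_n}$, let $\mathrm U\widehat{\mathrm V}_n$ be the class of promise problems that are polynomial-time many-one reducible to $\mathrm{UVAL}_n$, and let $\widehat{\mathrm P}^{\mathrm U\widehat{\mathrm V}_n}:=\widehat{\mathrm P}^{\mathrm{UVAL}_n}$; then $\widehat{\mathrm P}^{\mathrm U\widehat{\mathrm V}_n}=\mathrm U\widehat\Delta_{n+1}$. -/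

import Mathlib

namespace PromiseHierarchy

/-! ### Promise problems -/

/-- A promise problem over the alphabet `Σ = {0, 1}`: it assigns to every string the non-empty set
of its valid answers, so the values are `{0}`, `{1}` and `Σ`. -/
def PromiseProblem : Type := List Bool → {A : Set Bool // A.Nonempty}

/-- The set of valid answers with value `A` where the promise `P` holds, and every answer is valid
where it does not. -/
def promise (A : Set Bool) (P : Prop) : Set Bool := {b | P → b ∈ A}

/-! ### Oracle Turing machines -/

/-- An oracle Turing machine, in the form of Mathlib's machine model `Turing.TM2` (finitely many
stacks, finitely many labels, finitely many internal states) extended by an oracle instruction.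
All stacks are over the alphabet `{0, 1}`. At each label stands either an ordinary statement
or an oracle call, together with the label at which the computation goes on after the call. -/
structure OracleTM where
  /-- The index set of the stacks. -/
  K : Type
  [decEqK : DecidableEq K]
  [finK : Fintype K]
  /-- The stack that holds the input at the start (first letter on top). -/
  inp : K
  /-- The stack that holds the query string of an oracle call, and the answer after the call. -/
  qry : K
  /-- The stack that holds the output at the end. -/
  out : K
  /-- The labels. -/
  L : Type
  [finL : Fintype L]
  /-- The label at which the computation starts. -/
  main : L
  /-- The internal states. -/
  Q : Type
  [finQ : Fintype Q]
  /-- The internal state in which the computation starts. -/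
  start : Q
  /-- The program. -/
  prog : L → Turing.TM2.Stmt (fun _ : K => Bool) L Q ⊕ L

attribute [instance] OracleTM.decEqK OracleTM.finK OracleTM.finL OracleTM.finQ

namespace OracleTM

/-- Configurations: the current label (`none` if the machine has halted), the internal state and
the contents of the stacks. -/
abbrev Cfg (M : OracleTM) : Type := Turing.TM2.Cfg (fun _ : M.K => Bool) M.L M.Q

/-- The initial configuration on input `x`. -/
def init (M : OracleTM) (x : List Bool) : M.Cfg :=
  ⟨some M.main, M.start, Function.update (fun _ => []) M.inp x⟩

/-- `M.Step φ c c'`: with an oracle for the promise problem `φ`, the machine may pass from `c` to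
`c'` in one step. An oracle call takes one step and replaces the contents `q` of the
query stack by one letter `y`, any element of `φ q`; nothing ties the choice of `y` to the
choices made in other calls. -/
inductive Step (M : OracleTM) (φ : PromiseProblem) : M.Cfg → M.Cfg → Prop
  | run {l : M.L} {s : Turing.TM2.Stmt (fun _ : M.K => Bool) M.L M.Q} (v : M.Q)
      (S : M.K → List Bool) (h : M.prog l = Sum.inl s) :
      Step M φ ⟨some l, v, S⟩ (Turing.TM2.stepAux s v S)
  | call {l l' : M.L} (v : M.Q) (S : M.K → List Bool) (y : Bool) (h : M.prog l = Sum.inr l')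
      (hy : y ∈ (φ (S M.qry)).1) :
      Step M φ ⟨some l, v, S⟩ ⟨some l', v, Function.update S M.qry [y]⟩

/-- `M.Path φ k c c'`: some path of exactly `k` steps leads from `c` to `c'`. -/
inductive Path (M : OracleTM) (φ : PromiseProblem) : ℕ → M.Cfg → M.Cfg → Prop
  | refl (c : M.Cfg) : Path M φ 0 c c
  | head {k : ℕ} {c₁ c₂ c₃ : M.Cfg} (h : M.Step φ c₁ c₂) (h' : Path M φ k c₂ c₃) :
      Path M φ (k + 1) c₁ c₃

end OracleTM

/-- Weak (Turing, Cook) reducibility `φ₁ ∝_T φ₂`: some oracle machine and some polynomial `p` are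
such that on every input `x`, every path of the machine with an oracle for `φ₂` has at most
`p(|x|)` steps, and if it has halted then its output is some `y ∈ φ₁ x`.
(Only halted configurations have no successor, so that every maximal path halts.) -/
def TuringReducible (φ₁ φ₂ : PromiseProblem) : Prop :=
  ∃ (M : OracleTM) (p : Polynomial ℕ), ∀ (x : List Bool) (k : ℕ) (c : M.Cfg),
    M.Path φ₂ k (M.init x) c →
      k ≤ p.eval x.length ∧ (c.l = none → ∃ y ∈ (φ₁ x).1, c.stk M.out = [y])

/-- The weak closure `P̂^φ`: all promise problems that are Turing reducible to `φ`. -/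
def weakClosure (φ : PromiseProblem) : Set PromiseProblem := {ψ | TuringReducible ψ φ}

/-! ### Functions of several strings, and alternating quantification -/

/-- Functions `Σ^{m₁} × ⋯ × Σ^{mₙ} → Σ`, in curried form. -/
def StrFun : List ℕ → Type
  | [] => Bool
  | m :: ms => (Fin m → Bool) → StrFun ms

mutual

/-- `SATₙ f = 1`, where `f` has `n` arguments: `∃ x⁽¹⁾, ∀ x⁽²⁾, ∃ x⁽³⁾, …, f x⁽¹⁾ … x⁽ⁿ⁾ = 1`. -/
def Sat : (ms : List ℕ) → StrFun ms → Prop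
  | [], f => f = true
  | m :: ms, f => ∃ x : Fin m → Bool, CoSat ms (f x)

/-- The dual problem: `∀ x⁽¹⁾, ∃ x⁽²⁾, ∀ x⁽³⁾, …, f x⁽¹⁾ … x⁽ⁿ⁾ = 1`. -/
def CoSat : (ms : List ℕ) → StrFun ms → Prop
  | [], f => f = true
  | m :: ms, f => ∀ x : Fin m → Bool, Sat ms (f x)

end

/-- The set of all `x` such that the dual problem of level `n - 1` has answer `1` at `f_x`, where
`f` has `n` arguments. -/
def solutions {m : ℕ} {ms : List ℕ} (f : StrFun (m :: ms)) : Set (Fin m → Bool) :=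
  {x | CoSat ms (f x)}

/-- The valid answers of `USATₙ` at `f`: the answer of `SATₙ`, under the promise that `f` has at
most one solution. -/
def usatAnswers {m : ℕ} {ms : List ℕ} (f : StrFun (m :: ms)) : Set Bool :=
  promise {b | b = true ↔ Sat (m :: ms) f} ((solutions f).encard ≤ 1)

/-- The valid answers of `UVALₙ` at `f`: the first letter of the solution, under the promise that
`f` has exactly one solution. -/
def uvalAnswers {m : ℕ} {ms : List ℕ} (hm : 0 < m) (f : StrFun (m :: ms)) : Set Bool :=
  promise ((fun x : Fin m → Bool => x ⟨0, hm⟩) '' solutions f) (∃! x, x ∈ solutions f)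

/-! ### Encoding of functions by boolean expressions -/

/-- Boolean expressions; `var i j` is the `j`-th letter of the `i`-th string argument (both counted
from `0`). -/
inductive Expr : Type
  | var (i j : ℕ)
  | not (e : Expr)
  | and (e₁ e₂ : Expr)
  | or (e₁ e₂ : Expr)

namespace Expr

/-- The value of an expression at an assignment. -/
def eval (a : ℕ → ℕ → Bool) : Expr → Bool
  | var i j => a i j
  | not e => !(e.eval a)
  | and e₁ e₂ => e₁.eval a && e₂.eval a
  | or e₁ e₂ => e₁.eval a || e₂.eval a

/-- All variables of the expression are letters of string arguments of the lengths `ms`. -/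
def Scoped (ms : List ℕ) : Expr → Prop
  | var i j => j < ms.getD i 0
  | not e => e.Scoped ms
  | and e₁ e₂ => e₁.Scoped ms ∧ e₂.Scoped ms
  | or e₁ e₂ => e₁.Scoped ms ∧ e₂.Scoped ms

/-- The function that is given by the expression, where the arguments from the `k`-th one on have
the lengths `ms`, and the assignment `a` has been fixed for the earlier ones. -/
def toFunFrom (e : Expr) : (ms : List ℕ) → (k : ℕ) → (a : ℕ → ℕ → Bool) → StrFun ms
  | [], _, a => e.eval a
  | m :: ms, k, a => fun x : Fin m → Bool =>
      e.toFunFrom ms (k + 1)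
        (Function.update a k (fun j => if h : j < m then x ⟨j, h⟩ else false))

/-- The function `Σ^{m₁} × ⋯ × Σ^{mₙ} → Σ` that is given by the expression. -/
def toFun (e : Expr) (ms : List ℕ) : StrFun ms := e.toFunFrom ms 0 (fun _ _ => false)

end Expr

/-- The self-delimiting unary code `1ᵏ0` of a number. -/
def unary (k : ℕ) : List Bool := List.replicate k true ++ [false]

/-- The code of an expression, in prefix notation. -/
def Expr.encode : Expr → List Bool
  | .var i j => [false, false] ++ unary i ++ unary j
  | .not e => [false, true] ++ e.encode
  | .and e₁ e₂ => [true, false] ++ e₁.encode ++ e₂.encode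
  | .or e₁ e₂ => [true, true] ++ e₁.encode ++ e₂.encode

/-- The instances of the problems of level `n`: a function `Σ^{m₁} × ⋯ × Σ^{mₙ} → Σ` with
`m₁ ≥ 1`, given by the lengths `m₁` (`first`) and `m₂, …, mₙ` (`rest`) and an expression. -/
structure Instance (n : ℕ) where
  first : ℕ
  rest : List ℕ
  expr : Expr
  first_pos : 0 < first
  level : rest.length + 1 = n
  expr_scoped : expr.Scoped (first :: rest)

/-- The function of an instance. -/
def Instance.fn {n : ℕ} (I : Instance n) : StrFun (I.first :: I.rest) :=
  I.expr.toFun (I.first :: I.rest)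

/-- The string that encodes an instance. -/
def Instance.encode {n : ℕ} (I : Instance n) : List Bool :=
  (I.first :: I.rest).flatMap unary ++ I.expr.encode

theorem unary_append_inj {k l : ℕ} {s t : List Bool} (h : unary k ++ s = unary l ++ t) :
    k = l ∧ s = t := by
  induction k generalizing l with
  | zero => cases l <;> simp_all [unary, List.replicate_succ]
  | succ k ih =>
    cases l with
    | zero => simp [unary, List.replicate_succ] at h
    | succ l =>
      have := @ih l (by simpa [unary, List.replicate_succ] using h)
      simp [this]

theorem flatMap_unary_append_inj {l₁ l₂ : List ℕ} {s t : List Bool}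
    (hl : l₁.length = l₂.length) (h : l₁.flatMap unary ++ s = l₂.flatMap unary ++ t) :
    l₁ = l₂ ∧ s = t := by
  induction l₁ generalizing l₂ with
  | nil => cases l₂ <;> simp_all
  | cons k l₁ ih =>
    cases l₂ with
    | nil => simp at hl
    | cons l l₂ =>
      rw [List.flatMap_cons, List.flatMap_cons, List.append_assoc, List.append_assoc] at h
      obtain ⟨rfl, h'⟩ := unary_append_inj h
      obtain ⟨rfl, h''⟩ := ih (by simpa using hl) h'
      exact ⟨rfl, h''⟩

theorem Expr.encode_append_inj {e₁ e₂ : Expr} {s t : List Bool}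
    (h : e₁.encode ++ s = e₂.encode ++ t) : e₁ = e₂ ∧ s = t := by
  induction e₁ generalizing e₂ s t with
  | var i j =>
    cases e₂ <;> simp only [Expr.encode, List.append_assoc, List.cons_append, List.nil_append,
      List.cons.injEq, reduceCtorEq, false_and, and_false, true_and] at h
    obtain ⟨rfl, h'⟩ := unary_append_inj h
    obtain ⟨rfl, h''⟩ := unary_append_inj h'
    exact ⟨rfl, h''⟩
  | not e ih =>
    cases e₂ <;> simp only [Expr.encode, List.append_assoc, List.cons_append, List.nil_append,
      List.cons.injEq, reduceCtorEq, false_and, and_false, true_and] at h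
    obtain ⟨rfl, h'⟩ := ih h
    exact ⟨rfl, h'⟩
  | and e e' ih ih' =>
    cases e₂ <;> simp only [Expr.encode, List.append_assoc, List.cons_append, List.nil_append,
      List.cons.injEq, reduceCtorEq, false_and, and_false, true_and] at h
    obtain ⟨rfl, h'⟩ := ih h
    obtain ⟨rfl, h''⟩ := ih' h'
    exact ⟨rfl, h''⟩
  | or e e' ih ih' =>
    cases e₂ <;> simp only [Expr.encode, List.append_assoc, List.cons_append, List.nil_append,
      List.cons.injEq, reduceCtorEq, false_and, and_false, true_and] at h
    obtain ⟨rfl, h'⟩ := ih h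
    obtain ⟨rfl, h''⟩ := ih' h'
    exact ⟨rfl, h''⟩

/-- Different instances have different codes. -/
theorem Instance.encode_injective (n : ℕ) :
    Function.Injective (Instance.encode : Instance n → List Bool) := by
  rintro ⟨m, ms, e, h₁, h₂, h₃⟩ ⟨m', ms', e', h₁', h₂', h₃'⟩ h
  have hl : (m :: ms).length = (m' :: ms').length := h₂.trans h₂'.symm
  obtain ⟨h, h'⟩ := flatMap_unary_append_inj hl h
  obtain ⟨rfl, rfl⟩ := List.cons.inj h
  obtain ⟨rfl, -⟩ := Expr.encode_append_inj (s := []) (t := []) (by simpa using h')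
  rfl

/-! ### The problems of level `n` -/

/-- The promise problem whose inputs are the codes of the instances of level `n`, with the valid
answers `A I` at the code of `I`. On a string that is not a code, every answer is valid. -/
def ofInstances {n : ℕ} (A : Instance n → Set Bool) (hA : ∀ I, (A I).Nonempty) :
    PromiseProblem := fun s =>
  ⟨{b | ∀ I : Instance n, I.encode = s → b ∈ A I}, by
    by_cases h : ∃ I : Instance n, I.encode = s
    · obtain ⟨I, rfl⟩ := h
      obtain ⟨b, hb⟩ := hA I
      exact ⟨b, fun J hJ => Instance.encode_injective n hJ ▸ hb⟩
    · exact ⟨true, fun I hI => (h ⟨I, hI⟩).elim⟩⟩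

/-- The promise problem `USATₙ`. -/
def USAT (n : ℕ) : PromiseProblem :=
  ofInstances (fun I : Instance n => usatAnswers I.fn) (fun I => by
    by_cases h : Sat (I.first :: I.rest) I.fn
    · exact ⟨true, fun _ => by simp [h]⟩
    · exact ⟨false, fun _ => by simp [h]⟩)

/-- The promise problem `UVALₙ`. -/
def UVAL (n : ℕ) : PromiseProblem :=
  ofInstances (fun I : Instance n => uvalAnswers I.first_pos I.fn) (fun I => by
    by_cases h : ∃! x, x ∈ solutions I.fn
    · obtain ⟨x, hx, -⟩ := h
      exact ⟨_, fun _ => ⟨x, hx, rfl⟩⟩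
    · exact ⟨true, fun h' => (h h').elim⟩)

/-- The class `UΔ̂ₙ₊₁`, as a function of `n`: the weak closure of `USATₙ`. -/
def UDeltaSucc (n : ℕ) : Set PromiseProblem := weakClosure (USAT n)

end PromiseHierarchy

-- Both inclusions rest on one principle, `TuringReducible.of_computes`: if a polynomial-time
-- program with an oracle for `χ` turns each query to `ψ` into a valid answer, then every problem
-- reducible to `ψ` is reducible to `χ`. It remains to answer `UVAL` with `USAT` and `USAT` with
-- `UVAL`.
--
-- For `UVAL` one query is enough. If `f` has exactly one solution, then `f` restricted to first
-- arguments with first letter 1 has at most one, and it has one iff the letter sought is 1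
-- (`Instance.mem_UVAL_of_withFirst`).
--
-- For `USAT`, the letters of a unique solution can be found by queries to `UVAL`. If there is no
-- solution, however, the answers are arbitrary, so the string `x` found must be checked by a query
-- that keeps the promise of `UVAL` whether or not `x` solves `f`. For this, `core` attaches to each
-- `x` a pair `(t, y)`: it is `(1, 0)` if `x` is a solution, and otherwise `(0, y)` with `y` the
-- least value of the second argument at which `x` fails. Exactly one pair is valid for each `x`
-- (`exists_validPair_iff`).
--
-- The formula must stay at level `n`. That each `z` either passes or satisfies `t = 0` and `y ≤ z`
-- takes `n - 1` alternating quantifiers, beginning with `∀ z`. That `y` fails is the negation of a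
-- statement beginning with `∃`, so it also begins with `∀` and has one quantifier fewer. The two
-- alternations are independent, and a conjunction of independent alternations of the same shape is
-- a single alternation over interleaved strings (`alt_interleave`, `Instance.mem_solutions_lift`).
--
-- A further first letter `b` carries the information asked for. The search queries demand `t = 1`
-- and `b = x_j`, with the letters after `j` already fixed; over a unique solution the answer is its
-- letter `j` (`IsPartial.literal`). The final query fixes all of `x` and demands `b = t`; it has
-- exactly one solution in any case, and the answer says whether `x` solves `f`
-- (`IsPartial.mem_USAT`).
--
-- The rest is the realisation on machines. Programs have a total-correctness semantics with time
-- bounds (`Prog.Must`), they are compiled to machine code (`OracleTM.within_code`), and the two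
-- reductions are written as such programs (`uvalProg_computes`, `usatProg_computes`).

namespace PromiseHierarchy

/-! ### Structured programs on stacks -/

/-- Structured programs that work on stacks of bits. -/
inductive Prog (K : Type) : Type
  /-- Do nothing. -/
  | skip
  /-- Push a letter. -/
  | push (k : K) (b : Bool)
  /-- Run two programs one after the other. -/
  | seq (p q : Prog K)
  /-- Pop a letter and continue according to whether the stack was empty, the letter was `1`,
  or the letter was `0`. -/
  | cases (k : K) (pN pT pF : Prog K)
  /-- Pop letters until the stack is empty and run `pT` after a letter `1` and `pF` after a
  letter `0`. If `halt` is set then the loop ends with the first letter `0`. -/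
  | loop (halt : Bool) (k : K) (pT pF : Prog K)
  /-- Call the oracle. -/
  | call

namespace Prog

variable {K : Type}

/-- The program that is run by `loop` after the letter `b`. -/
abbrev branch (pT pF : Prog K) : Bool → Prog K
  | true => pT
  | false => pF

/-- `p.Must χ qry S t R`: whatever the oracle for `χ` answers to queries on the stack `qry`, the
program `p` started in `S` ends after at most `t` steps in a state that satisfies `R`. -/
inductive Must [DecidableEq K] (χ : PromiseProblem) (qry : K) :
    Prog K → (K → List Bool) → ℕ → ((K → List Bool) → Prop) → Prop
  | skip {S R} (h : R S) : Must χ qry skip S 1 R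
  | push {k b S R} (h : R (Function.update S k (b :: S k))) : Must χ qry (push k b) S 1 R
  | seq {p q S t u R R'} (h : Must χ qry p S t R) (h' : ∀ S', R S' → Must χ qry q S' u R') :
      Must χ qry (seq p q) S (t + u) R'
  | casesNil {k pN pT pF S t R} (hk : S k = []) (h : Must χ qry pN S t R) :
      Must χ qry (cases k pN pT pF) S (t + 1) R
  | casesCons {k pN pT pF S b l t R} (hk : S k = b :: l)
      (h : Must χ qry (branch pT pF b) (Function.update S k l) t R) :
      Must χ qry (cases k pN pT pF) S (t + 1) R
  | loopNil {halt k pT pF S R} (hk : S k = []) (h : R S) : Must χ qry (loop halt k pT pF) S 1 R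
  | loopCons {halt k pT pF S b l t u R R'} (hk : S k = b :: l) (hb : (halt && !b) = false)
      (h : Must χ qry (branch pT pF b) (Function.update S k l) t R)
      (h' : ∀ S', R S' → Must χ qry (loop halt k pT pF) S' u R') :
      Must χ qry (loop halt k pT pF) S (t + u + 1) R'
  | loopHalt {k pT pF S l t R} (hk : S k = false :: l)
      (h : Must χ qry pF (Function.update S k l) t R) :
      Must χ qry (loop true k pT pF) S (t + 1) R
  | call {S R} (h : ∀ y ∈ (χ (S qry)).1, R (Function.update S qry [y])) : Must χ qry call S 1 R
  | mono {p S t u R R'} (h : Must χ qry p S t R) (htu : t ≤ u) (hR : ∀ S', R S' → R' S') :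
      Must χ qry p S u R'

/-- The labels of the machine code of a program. -/
def Label : Prog K → Type
  | skip => Unit
  | push _ _ => Unit
  | seq p q => p.Label ⊕ q.Label
  | cases _ pN pT pF => Option (pN.Label ⊕ pT.Label ⊕ pF.Label)
  | loop _ _ pT pF => Option (pT.Label ⊕ pF.Label)
  | call => Unit

/-- The first label of the machine code of a program. -/
def entry : (p : Prog K) → p.Label
  | skip => ()
  | push _ _ => ()
  | seq p _ => Sum.inl p.entry
  | cases _ _ _ _ => none
  | loop _ _ _ _ => none
  | call => ()

/-- The labels of a program form a finite type. -/
@[reducible]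
def fintypeLabel : (p : Prog K) → Fintype p.Label
  | skip => inferInstanceAs (Fintype Unit)
  | push _ _ => inferInstanceAs (Fintype Unit)
  | seq p q =>
      haveI := p.fintypeLabel
      haveI := q.fintypeLabel
      inferInstanceAs (Fintype (p.Label ⊕ q.Label))
  | cases _ pN pT pF =>
      haveI := pN.fintypeLabel
      haveI := pT.fintypeLabel
      haveI := pF.fintypeLabel
      inferInstanceAs (Fintype (Option (pN.Label ⊕ pT.Label ⊕ pF.Label)))
  | loop _ _ pT pF =>
      haveI := pT.fintypeLabel
      haveI := pF.fintypeLabel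
      inferInstanceAs (Fintype (Option (pT.Label ⊕ pF.Label)))
  | call => inferInstanceAs (Fintype Unit)

instance (p : Prog K) : Fintype p.Label := p.fintypeLabel

/-- Pop a letter and jump. -/
def popGoto {K' L Q : Type} (k : K') (lN lT lF : L) :
    Turing.TM2.Stmt (fun _ : K' => Bool) L (Q × Option Bool) :=
  .pop k (fun v o => (v.1, o)) (.goto fun v =>
    match v.2 with
    | none => lN
    | some true => lT
    | some false => lF)

/-- The machine code of a program, where the stacks are renamed by `ι`, the labels by `e`, and the
code is left to the label `exit`. -/
def code {K' L Q : Type} (ι : K → K') : (p : Prog K) → (e : p.Label → L) → (exit : L) → p.Label →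
    Turing.TM2.Stmt (fun _ : K' => Bool) L (Q × Option Bool) ⊕ L
  | skip, _, exit, _ => Sum.inl (.goto fun _ => exit)
  | push k b, _, exit, _ => Sum.inl (.push (ι k) (fun _ => b) (.goto fun _ => exit))
  | seq p q, e, _, Sum.inl x =>
      p.code ι (fun y => e (Sum.inl y)) (e (Sum.inr q.entry)) x
  | seq _ q, e, exit, Sum.inr x => q.code ι (fun y => e (Sum.inr y)) exit x
  | cases k pN pT pF, e, _, none =>
      Sum.inl (popGoto (ι k) (e (some (Sum.inl pN.entry)))
        (e (some (Sum.inr (Sum.inl pT.entry)))) (e (some (Sum.inr (Sum.inr pF.entry)))))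
  | cases _ pN _ _, e, exit, some (Sum.inl x) =>
      pN.code ι (fun y => e (some (Sum.inl y))) exit x
  | cases _ _ pT _, e, exit, some (Sum.inr (Sum.inl x)) =>
      pT.code ι (fun y => e (some (Sum.inr (Sum.inl y)))) exit x
  | cases _ _ _ pF, e, exit, some (Sum.inr (Sum.inr x)) =>
      pF.code ι (fun y => e (some (Sum.inr (Sum.inr y)))) exit x
  | loop _ k pT pF, e, exit, none =>
      Sum.inl (popGoto (ι k) exit (e (some (Sum.inl pT.entry))) (e (some (Sum.inr pF.entry))))
  | loop _ _ pT _, e, _, some (Sum.inl x) =>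
      pT.code ι (fun y => e (some (Sum.inl y))) (e none) x
  | loop halt _ _ pF, e, exit, some (Sum.inr x) =>
      pF.code ι (fun y => e (some (Sum.inr y))) (bif halt then exit else e none) x
  | call, _, exit, _ => Sum.inr exit

end Prog

/-! ### Bounded termination of oracle machines -/

namespace OracleTM

variable {M : OracleTM} {φ : PromiseProblem}

/-- Every path from the configuration reaches `R` within `t` steps. -/
inductive Within (M : OracleTM) (φ : PromiseProblem) (R : M.Cfg → Prop) : ℕ → M.Cfg → Prop
  | done {t c} (h : R c) : Within M φ R t c
  | step {t c} (hl : c.l ≠ none) (h : ∀ c', M.Step φ c c' → Within M φ R t c') :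
      Within M φ R (t + 1) c

theorem Within.mono {R R' : M.Cfg → Prop} {t u : ℕ} {c : M.Cfg} (h : M.Within φ R t c)
    (htu : t ≤ u) (hR : ∀ c, R c → R' c) : M.Within φ R' u c := by
  induction h generalizing u with
  | done h => exact .done (hR _ h)
  | step hl h ih =>
    obtain ⟨u, rfl⟩ : ∃ w, u = w + 1 := ⟨u - 1, by omega⟩
    exact .step hl fun c' hc => ih c' hc (by omega)

theorem Within.trans {R R' : M.Cfg → Prop} {t u : ℕ} {c : M.Cfg} (h : M.Within φ R t c)
    (h' : ∀ c, R c → M.Within φ R' u c) : M.Within φ R' (t + u) c := by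
  induction h with
  | done h => exact (h' _ h).mono (by omega) fun _ => id
  | @step t c hl h ih =>
    rw [show t + 1 + u = t + u + 1 by omega]
    exact .step hl ih

theorem not_step_of_halted {c c' : M.Cfg} (hc : c.l = none) : ¬ M.Step φ c c' := by
  intro h
  cases h <;> simp at hc

/-- Links `Within` to the form in which `TuringReducible` is stated. The condition `c.l ≠ none` in
`Within.step` is needed here: a halted configuration has no successors and would otherwise satisfy
`Within` vacuously. -/
theorem Within.path {R : M.Cfg → Prop} (hR : ∀ c, R c → c.l = none) {t : ℕ} {c : M.Cfg}
    (h : M.Within φ R t c) {k : ℕ} {c' : M.Cfg} (hp : M.Path φ k c c') :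
    k ≤ t ∧ (c'.l = none → R c') := by
  induction h generalizing k with
  | done h =>
    cases hp with
    | refl => exact ⟨Nat.zero_le _, fun _ => h⟩
    | head h₁ => exact (not_step_of_halted (hR _ h) h₁).elim
  | step hl h ih =>
    cases hp with
    | refl => exact ⟨Nat.zero_le _, fun h => (hl h).elim⟩
    | head h₁ h₂ =>
      obtain ⟨h₃, h₄⟩ := ih _ h₁ h₂
      exact ⟨by omega, h₄⟩

theorem Path.snoc {k : ℕ} {c₁ c₂ c₃ : M.Cfg} (h : M.Path φ k c₁ c₂) (h' : M.Step φ c₂ c₃) :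
    M.Path φ (k + 1) c₁ c₃ := by
  induction h with
  | refl c => exact .head h' (.refl _)
  | head h₁ _ ih => exact .head h₁ (ih h')

theorem Within.run {R : M.Cfg → Prop} {t : ℕ} {l : M.L} {s} (h : M.prog l = Sum.inl s)
    {v : M.Q} {S : M.K → List Bool} (h' : M.Within φ R t (Turing.TM2.stepAux s v S)) :
    M.Within φ R (t + 1) ⟨some l, v, S⟩ := by
  refine .step (by simp) fun c' hc => ?_
  cases hc with
  | run _ _ h₁ =>
    rw [h] at h₁
    cases h₁
    exact h'
  | call _ _ _ h₁ _ => rw [h] at h₁; cases h₁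

theorem Within.call {R : M.Cfg → Prop} {t : ℕ} {l l' : M.L} (h : M.prog l = Sum.inr l')
    {v : M.Q} {S : M.K → List Bool} (h' : ∀ y ∈ (φ (S M.qry)).1,
      M.Within φ R t ⟨some l', v, Function.update S M.qry [y]⟩) :
    M.Within φ R (t + 1) ⟨some l, v, S⟩ := by
  refine .step (by simp) fun c' hc => ?_
  cases hc with
  | run _ _ h₁ => rw [h] at h₁; cases h₁
  | call _ _ y h₁ hy =>
    rw [h] at h₁
    cases h₁
    exact h' y hy

/-! ### Replacing oracle calls by programs -/

variable {K : Type} [DecidableEq K]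

/-- The renaming of the stacks of a program that is run in place of oracle calls: the stack `inp`
becomes the query stack of the calling machine. -/
def stackEmb {K₁ : Type} (inp : K) (q : K₁) (k : K) : K₁ ⊕ K :=
  if k = inp then Sum.inl q else Sum.inr k

theorem stackEmb_injective {K₁ : Type} (inp : K) (q : K₁) :
    Function.Injective (stackEmb inp q) := by
  intro k l h
  unfold stackEmb at h
  split_ifs at h <;> simp_all

/-- A statement of a machine as a statement of a machine with more stacks, labels and states. -/
def liftStmt {K₁ L₁ Q₁ : Type} (K L : Type) : Turing.TM2.Stmt (fun _ : K₁ => Bool) L₁ Q₁ →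
    Turing.TM2.Stmt (fun _ : K₁ ⊕ K => Bool) (L₁ ⊕ L) (Q₁ × Option Bool)
  | .push k f s => .push (Sum.inl k) (fun v => f v.1) (liftStmt K L s)
  | .peek k f s => .peek (Sum.inl k) (fun v o => (f v.1 o, v.2)) (liftStmt K L s)
  | .pop k f s => .pop (Sum.inl k) (fun v o => (f v.1 o, v.2)) (liftStmt K L s)
  | .load f s => .load (fun v => (f v.1, v.2)) (liftStmt K L s)
  | .branch f s s' => .branch (fun v => f v.1) (liftStmt K L s) (liftStmt K L s')
  | .goto f => .goto fun v => Sum.inl (f v.1)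
  | .halt => .halt

theorem stepAux_liftStmt {K₁ L₁ Q₁ L : Type} [DecidableEq K₁]
    (s : Turing.TM2.Stmt (fun _ : K₁ => Bool) L₁ Q₁) (v : Q₁) (r : Option Bool)
    (S : K₁ → List Bool) (S' : K → List Bool) :
    Turing.TM2.stepAux (liftStmt K L s) (v, r) (Sum.elim S S') =
      ⟨(Turing.TM2.stepAux s v S).l.map Sum.inl, ((Turing.TM2.stepAux s v S).var, r),
        Sum.elim (Turing.TM2.stepAux s v S).stk S'⟩ := by
  induction s generalizing v S with
  | push k f s ih =>
    simp only [liftStmt, Turing.TM2.stepAux, Sum.elim_inl]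
    rw [← ih, Sum.update_elim_inl]
  | peek k f s ih => simp only [liftStmt, Turing.TM2.stepAux, Sum.elim_inl]; rw [← ih]
  | pop k f s ih =>
    simp only [liftStmt, Turing.TM2.stepAux, Sum.elim_inl]
    rw [← ih, Sum.update_elim_inl]
  | load f s ih => simp only [liftStmt, Turing.TM2.stepAux]; rw [← ih]
  | branch f s s' ih ih' =>
    simp only [liftStmt, Turing.TM2.stepAux]
    cases f v
    · simpa using ih' v S
    · simpa using ih v S
  | goto f => simp [liftStmt, Turing.TM2.stepAux]
  | halt => simp [liftStmt, Turing.TM2.stepAux]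

/-- The machine `M` with its oracle calls replaced by the program `P`, which takes the query from
the stack `inp`, leaves the answer there, and has its own query stack `qry`. -/
def inlined [Fintype K] (M : OracleTM) (P : Prog K) (inp qry : K) : OracleTM where
  K := M.K ⊕ K
  inp := Sum.inl M.inp
  qry := stackEmb inp M.qry qry
  out := Sum.inl M.out
  L := M.L ⊕ M.L × P.Label
  main := Sum.inl M.main
  Q := M.Q × Option Bool
  start := (M.start, none)
  prog
    | Sum.inl l =>
      match M.prog l with
      | Sum.inl s => Sum.inl (liftStmt K _ s)
      | Sum.inr _ => Sum.inl (.goto fun _ => Sum.inr (l, P.entry))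
    | Sum.inr (l, x) =>
      P.code (stackEmb inp M.qry) (fun y => Sum.inr (l, y))
        (match M.prog l with
          | Sum.inl _ => Sum.inl l
          | Sum.inr l' => Sum.inl l') x

/-- Correctness of the compiler, by induction on the derivation of `Must`. The embedding `e` of the
labels and the label `exit` are arbitrary, so that the induction hypotheses apply to subprograms.
The last clause is a frame condition: stacks of `M` other than its query stack are untouched, and
the state of `M` survives; only the register for the last popped letter changes. -/
theorem within_code [Fintype K] {χ : PromiseProblem} {P : Prog K} {inp qry : K}
    {p : Prog K} {S₀ : K → List Bool} {t : ℕ} {R : (K → List Bool) → Prop}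
    (hp : p.Must χ qry S₀ t R) (e : p.Label → (M.inlined P inp qry).L)
    (exit : (M.inlined P inp qry).L)
    (he : ∀ x, (M.inlined P inp qry).prog (e x) = p.code (stackEmb inp M.qry) e exit x)
    (v : M.Q × Option Bool) (S : M.K ⊕ K → List Bool) (hS : S ∘ stackEmb inp M.qry = S₀) :
    (M.inlined P inp qry).Within χ (fun c => ∃ r S', c = ⟨some exit, (v.1, r), S'⟩ ∧
      R (S' ∘ stackEmb inp M.qry) ∧ ∀ k ∉ Set.range (stackEmb inp M.qry), S' k = S k)
      t ⟨some (e p.entry), v, S⟩ := by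
  have hι := stackEmb_injective inp M.qry
  have hupd : ∀ (S : M.K ⊕ K → List Bool) k (l : List Bool),
      Function.update S (stackEmb inp M.qry k) l ∘ stackEmb inp M.qry =
        Function.update (S ∘ stackEmb inp M.qry) k l := fun S k l =>
    Function.update_comp_eq_of_injective S hι k l
  have hne : ∀ (S : M.K ⊕ K → List Bool) k (l : List Bool),
      ∀ k' ∉ Set.range (stackEmb inp M.qry),
        Function.update S (stackEmb inp M.qry k) l k' = S k' := fun S k l k' hk' =>
    Function.update_of_ne (fun h => hk' ⟨k, h.symm⟩) _ _
  induction hp generalizing exit v S with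
  | @skip S₀ R h =>
    subst hS
    exact .run (he ()) (.done ⟨v.2, S, rfl, h, fun _ _ => rfl⟩)
  | @push k b S₀ R h =>
    subst hS
    refine .run (he ()) (.done ?_)
    exact ⟨v.2, _, rfl, (congrArg R (hupd S k _)).mpr h, hne _ _ _⟩
  | @seq p q S₀ t u R R' h h' ih ih' =>
    refine (ih (fun y => e (Sum.inl y)) (e (Sum.inr q.entry)) (fun x => he (Sum.inl x)) v S hS).trans ?_
    rintro _ ⟨r, S', rfl, hR, hS'⟩
    refine (ih' _ hR (fun y => e (Sum.inr y)) exit (fun x => he (Sum.inr x)) _ S' rfl).mono le_rfl ?_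
    rintro _ ⟨r', S'', rfl, hR', hS''⟩
    exact ⟨r', S'', rfl, hR', fun k hk => (hS'' k hk).trans (hS' k hk)⟩
  | @casesNil k pN pT pF S₀ t R hk h ih =>
    subst hS
    refine .run (he none) ?_
    have hk' : S (stackEmb inp M.qry k) = [] := hk
    -- A pop from an empty stack writes the tail of `[]` back, so the new contents are formally an
    -- update of `S`.
    have hid : Function.update S (stackEmb inp M.qry k) [] = S := by rw [← hk', Function.update_eq_self]
    have := ih (fun y => e (some (Sum.inl y))) exit (fun x => he (some (Sum.inl x))) (v.1, none) S rfl
    simp only [Prog.popGoto, Turing.TM2.stepAux, hk', List.head?, List.tail]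
    exact (congrArg (fun T => (M.inlined P inp qry).Within χ _ t ⟨_, _, T⟩) hid).mpr this
  | @casesCons k pN pT pF S₀ b l t R hk h ih =>
    subst hS
    refine .run (he none) ?_
    have hk' : S (stackEmb inp M.qry k) = b :: l := hk
    cases b
    · have := ih (fun y => e (some (Sum.inr (Sum.inr y)))) exit
        (fun x => he (some (Sum.inr (Sum.inr x)))) (v.1, some false) _ (hupd S k l)
      simp only [Prog.popGoto, Turing.TM2.stepAux, hk', List.head?, List.tail]
      refine this.mono le_rfl ?_
      rintro _ ⟨r', S'', rfl, hR', hS''⟩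
      exact ⟨r', S'', rfl, hR', fun k' hk' => (hS'' k' hk').trans (hne _ _ _ k' hk')⟩
    · have := ih (fun y => e (some (Sum.inr (Sum.inl y)))) exit
        (fun x => he (some (Sum.inr (Sum.inl x)))) (v.1, some true) _ (hupd S k l)
      simp only [Prog.popGoto, Turing.TM2.stepAux, hk', List.head?, List.tail]
      refine this.mono le_rfl ?_
      rintro _ ⟨r', S'', rfl, hR', hS''⟩
      exact ⟨r', S'', rfl, hR', fun k' hk' => (hS'' k' hk').trans (hne _ _ _ k' hk')⟩
  | @loopNil halt k pT pF S₀ R hk h =>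
    subst hS
    refine .run (he none) (.done ?_)
    have hk' : S (stackEmb inp M.qry k) = [] := hk
    have hid : Function.update S (stackEmb inp M.qry k) [] = S := by rw [← hk', Function.update_eq_self]
    refine ⟨none, S, ?_, h, fun _ _ => rfl⟩
    simp only [Prog.popGoto, Turing.TM2.stepAux, hk', List.head?, List.tail]
    exact congrArg (Turing.TM2.Cfg.mk _ _) hid
  | @loopCons halt k pT pF S₀ b l t u R R' hk hb h h' ih ih' =>
    subst hS
    refine .run (he none) ?_
    have hk' : S (stackEmb inp M.qry k) = b :: l := hk
    -- The body of the loop exits to the label `e none` of the loop itself, where the induction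
    -- hypothesis for the remaining rounds takes over.
    have key : ∀ c, (∃ r S', c = ⟨some (e none), (v.1, r), S'⟩ ∧
        R (S' ∘ stackEmb inp M.qry) ∧ ∀ k ∉ Set.range (stackEmb inp M.qry), S' k = S k) →
        (M.inlined P inp qry).Within χ (fun c => ∃ r S', c = ⟨some exit, (v.1, r), S'⟩ ∧
          R' (S' ∘ stackEmb inp M.qry) ∧ ∀ k ∉ Set.range (stackEmb inp M.qry), S' k = S k) u c := by
      rintro _ ⟨r, S', rfl, hR, hS'⟩
      refine (ih' _ hR e exit he _ S' rfl).mono le_rfl ?_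
      rintro _ ⟨r', S'', rfl, hR', hS''⟩
      exact ⟨r', S'', rfl, hR', fun k hk => (hS'' k hk).trans (hS' k hk)⟩
    cases b
    · have hh : halt = false := by simpa using hb
      subst hh
      have := ih (fun y => e (some (Sum.inr y))) (e none)
        (fun x => he (some (Sum.inr x))) (v.1, some false) _ (hupd S k l)
      simp only [Prog.popGoto, Turing.TM2.stepAux, hk', List.head?, List.tail]
      refine (this.mono le_rfl ?_).trans key
      rintro _ ⟨r', S'', rfl, hR', hS''⟩
      exact ⟨r', S'', rfl, hR', fun k' hk' => (hS'' k' hk').trans (hne _ _ _ k' hk')⟩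
    · have := ih (fun y => e (some (Sum.inl y))) (e none)
        (fun x => he (some (Sum.inl x))) (v.1, some true) _ (hupd S k l)
      simp only [Prog.popGoto, Turing.TM2.stepAux, hk', List.head?, List.tail]
      refine (this.mono le_rfl ?_).trans key
      rintro _ ⟨r', S'', rfl, hR', hS''⟩
      exact ⟨r', S'', rfl, hR', fun k' hk' => (hS'' k' hk').trans (hne _ _ _ k' hk')⟩
  | @loopHalt k pT pF S₀ l t R hk h ih =>
    subst hS
    refine .run (he none) ?_
    have hk' : S (stackEmb inp M.qry k) = false :: l := hk
    have := ih (fun y => e (some (Sum.inr y))) exit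
      (fun x => he (some (Sum.inr x))) (v.1, some false) _ (hupd S k l)
    simp only [Prog.popGoto, Turing.TM2.stepAux, hk', List.head?, List.tail]
    refine this.mono le_rfl ?_
    rintro _ ⟨r', S'', rfl, hR', hS''⟩
    exact ⟨r', S'', rfl, hR', fun k' hk' => (hS'' k' hk').trans (hne _ _ _ k' hk')⟩
  | @call S₀ R h =>
    subst hS
    refine .call (he ()) fun y hy => .done ?_
    exact ⟨v.2, _, rfl, (congrArg R (hupd S qry _)).mpr (h y hy), hne _ _ _⟩
  | @mono p S₀ t u R R' h htu hR ih =>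
    refine (ih e exit he v S hS).mono htu ?_
    rintro _ ⟨r', S'', rfl, hR', hS''⟩
    exact ⟨r', S'', rfl, hR _ hR', hS''⟩

end OracleTM
end PromiseHierarchy
-- Growth of stacks, and substitution of programs for oracle calls
namespace PromiseHierarchy

theorem polynomial_eval_mono (p : Polynomial ℕ) : Monotone fun n => p.eval n := by
  intro a b h
  simp only [Polynomial.eval_eq_sum_range]
  gcongr

namespace OracleTM

/-- A single step may execute several pushes, but no more than occur in the statement. -/
theorem exists_growth_stepAux {K L Q : Type} [DecidableEq K]
    (s : Turing.TM2.Stmt (fun _ : K => Bool) L Q) :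
    ∃ g, ∀ v (S : K → List Bool) k,
      ((Turing.TM2.stepAux s v S).stk k).length ≤ (S k).length + g := by
  induction s with
  | push k f s ih =>
    obtain ⟨g, hg⟩ := ih
    refine ⟨g + 1, fun v S k' => (hg _ _ _).trans ?_⟩
    by_cases h : k' = k
    · subst h; simp; omega
    · rw [Function.update_of_ne h]; omega
  | peek k f s ih =>
    obtain ⟨g, hg⟩ := ih
    exact ⟨g, fun v S k' => hg _ _ _⟩
  | pop k f s ih =>
    obtain ⟨g, hg⟩ := ih
    refine ⟨g, fun v S k' => (hg _ _ _).trans ?_⟩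
    by_cases h : k' = k
    · subst h; simp
    · rw [Function.update_of_ne h]
  | load f s ih =>
    obtain ⟨g, hg⟩ := ih
    exact ⟨g, fun v S k' => hg _ _ _⟩
  | branch f s s' ih ih' =>
    obtain ⟨g, hg⟩ := ih
    obtain ⟨g', hg'⟩ := ih'
    refine ⟨g + g', fun v S k' => ?_⟩
    simp only [Turing.TM2.stepAux]
    have := hg v S k'
    have := hg' v S k'
    cases f v <;> simp only [cond] <;> omega
  | goto f => exact ⟨0, fun v S k => by simp [Turing.TM2.stepAux]⟩
  | halt => exact ⟨0, fun v S k => by simp [Turing.TM2.stepAux]⟩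

/-- The stacks of an oracle machine grow by at most a constant in each step. -/
theorem exists_growth (M : OracleTM) : ∃ g, ∀ φ c c', M.Step φ c c' →
    ∀ k, (c'.stk k).length ≤ (c.stk k).length + g := by
  have h : ∀ l, ∃ g, ∀ s, M.prog l = Sum.inl s → ∀ v (S : M.K → List Bool) k,
      ((Turing.TM2.stepAux s v S).stk k).length ≤ (S k).length + g := by
    intro l
    cases h : M.prog l with
    | inl s =>
      obtain ⟨g, hg⟩ := exists_growth_stepAux s
      exact ⟨g, fun s' h' => by cases h'; exact hg⟩
    | inr l' => exact ⟨0, fun s' h' => by cases h'⟩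
  choose g hg using h
  -- There are finitely many labels, so the sum bounds every `g l`; the `1` is for the letter
  -- returned by the oracle.
  refine ⟨∑ l, g l + 1, fun φ c c' hc k => ?_⟩
  cases hc with
  | @run l s v S h =>
    have := hg l s h v S k
    have h' := Finset.single_le_sum (f := g) (fun _ _ => Nat.zero_le _) (Finset.mem_univ l)
    show _ ≤ (S k).length + _
    omega
  | @call l l' v S y h hy =>
    show (Function.update S M.qry [y] k).length ≤ (S k).length + _
    by_cases hk : k = M.qry
    · subst hk; simp; omega
    · rw [Function.update_of_ne hk]; omega

theorem Path.length_le {M : OracleTM} {φ : PromiseProblem} {g : ℕ}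
    (hg : ∀ φ c c', M.Step φ c c' → ∀ k, (c'.stk k).length ≤ (c.stk k).length + g)
    {n : ℕ} {c c' : M.Cfg} (h : M.Path φ n c c') (k : M.K) :
    (c'.stk k).length ≤ (c.stk k).length + n * g := by
  induction h with
  | refl c => simp
  | head h h' ih => have := hg _ _ _ h k; rw [Nat.add_mul]; omega

end OracleTM

/-- The program `P`, started with a query `q` on the stack `inp` and all other stacks empty,
replaces `q` by a valid answer of `ψ` at `q` in polynomial time. -/
def Prog.Computes {K : Type} [DecidableEq K] (P : Prog K) (inp qry : K) (ψ χ : PromiseProblem) :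
    Prop :=
  ∃ p : Polynomial ℕ, ∀ q : List Bool,
    P.Must χ qry (Function.update (fun _ => []) inp q) (p.eval q.length)
      fun S => ∃ y ∈ (ψ q).1, S = Function.update (fun _ => []) inp [y]

/-- Oracle calls can be replaced by programs that compute the answers with another oracle. -/
theorem TuringReducible.of_computes {K : Type} [DecidableEq K] [Fintype K] {P : Prog K}
    {inp qry : K} {φ ψ χ : PromiseProblem} (hP : P.Computes inp qry ψ χ)
    (h : TuringReducible φ ψ) : TuringReducible φ χ := by
  obtain ⟨M, p₁, hM⟩ := h
  obtain ⟨p₂, hP⟩ := hP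
  obtain ⟨g, hg⟩ := M.exists_growth
  let N := M.inlined P inp qry
  let emb : M.Cfg → Option Bool → N.Cfg := fun c r =>
    ⟨c.l.map Sum.inl, (c.var, r), Sum.elim c.stk (fun _ => [])⟩
  -- The first factor bounds the number of simulated steps of `M`; the second bounds the cost of one
  -- of them, since a query has length at most `|x| + p₁(|x|) * g`.
  refine ⟨N, (p₁ + 1) * (p₂.comp (Polynomial.X + p₁ * Polynomial.C g) + 2), fun x => ?_⟩
  set T := p₂.eval (x.length + p₁.eval x.length * g) + 2 with hT
  -- Induction on the number `d` of steps that `M` may still make. The case `d = 0` is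
  -- contradictory, because paths of `M` have at most `p₁(|x|)` steps; hence `M` has halted before
  -- `d` is used up.
  have key : ∀ d k c r, k + d = p₁.eval x.length + 1 → M.Path ψ k (M.init x) c →
      N.Within χ (fun c' => ∃ c r k, c' = emb c r ∧ c.l = none ∧ M.Path ψ k (M.init x) c)
        (d * T) (emb c r) := by
    intro d
    induction d with
    | zero =>
      intro k c r hk hc
      have := (hM x k c hc).1
      omega
    | succ d ih =>
      intro k c r hk hc
      by_cases hl : c.l = none
      · exact .done ⟨c, r, k, rfl, hl, hc⟩
      obtain ⟨l, v, S⟩ := c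
      cases l with
      | none => simp at hl
      | some l =>
        cases hp : M.prog l with
        | inl s =>
          have h₁ := ih (k + 1) _ r (by omega) (hc.snoc (.run v S hp))
          have h₂ : N.prog (Sum.inl l) = Sum.inl (OracleTM.liftStmt K _ s) := by
            simp only [N, OracleTM.inlined, hp]
          have h₃ := OracleTM.stepAux_liftStmt (L := M.L × P.Label) s v r S (fun _ : K => [])
          refine (OracleTM.Within.run (t := d * T) h₂ ?_).mono ?_ fun _ => id
          · exact (congrArg (N.Within χ _ (d * T)) h₃).mpr h₁
          · rw [Nat.add_mul]; omega
        | inr l' =>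
          have h₂ : N.prog (Sum.inl l) = Sum.inl (.goto fun _ => Sum.inr (l, P.entry)) := by
            simp only [N, OracleTM.inlined, hp]
          have hq : (S M.qry).length ≤ x.length + p₁.eval x.length * g := by
            have h₃ := hc.length_le hg M.qry
            have h₄ : (((M.init x).stk M.qry).length) ≤ x.length := by
              show (Function.update (fun _ => []) M.inp x M.qry).length ≤ _
              by_cases hi : M.qry = M.inp
              · rw [hi]; simp
              · rw [Function.update_of_ne hi]; simp
            have h₅ : k * g ≤ p₁.eval x.length * g := Nat.mul_le_mul_right _ (hM x k _ hc).1
            exact h₃.trans (by omega)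
          have hS : (Sum.elim S (fun _ : K => ([] : List Bool))) ∘ OracleTM.stackEmb inp M.qry =
              Function.update (fun _ => []) inp (S M.qry) := by
            funext k'
            by_cases h : k' = inp
            · subst h; simp [OracleTM.stackEmb]
            · simp [OracleTM.stackEmb, h]
          have h₃ := OracleTM.within_code (M := M) (P := P) (hP (S M.qry)) (fun y => Sum.inr (l, y))
            (Sum.inl l') (by intro y; simp only [OracleTM.inlined, hp]) (v, r) _ hS
          have h₄ : N.Within χ _ _ ⟨some (Sum.inl l), (v, r), Sum.elim S (fun _ => [])⟩ :=
            (OracleTM.Within.run h₂ h₃).trans (u := d * T)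
              (R' := fun c' => ∃ c r k, c' = emb c r ∧ c.l = none ∧ M.Path ψ k (M.init x) c) (by
                rintro _ ⟨r', S', rfl, ⟨y, hy, hS'⟩, hS''⟩
                have h₁ := ih (k + 1) _ r' (by omega) (hc.snoc (.call v S y hp hy))
                -- The program leaves its own stacks empty, so the result is again the image of a
                -- configuration of `M` and the next call starts cleanly.
                have : S' = Sum.elim (Function.update S M.qry [y]) (fun _ => []) := by
                  funext k'
                  by_cases hk' : k' ∈ Set.range (OracleTM.stackEmb inp M.qry)
                  · obtain ⟨k', rfl⟩ := hk'
                    refine (congrFun hS' k').trans ?_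
                    by_cases h : k' = inp
                    · subst h; simp [OracleTM.stackEmb]
                    · simp [OracleTM.stackEmb, h]
                  · rw [hS'' k' hk']
                    cases k' with
                    | inl k' =>
                      have : k' ≠ M.qry := by
                        rintro rfl
                        exact hk' ⟨inp, by simp [OracleTM.stackEmb]⟩
                      simp [this]
                    | inr k' => simp
                subst this
                exact h₁)
          refine h₄.mono ?_ fun _ => id
          have := polynomial_eval_mono p₂ hq
          simp only at this
          rw [Nat.add_mul]
          omega
  intro k c hc
  have h₁ := key (p₁.eval x.length + 1) 0 (M.init x) none (by omega) (.refl _)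
  have h₂ : emb (M.init x) none = N.init x := by
    simp only [emb, OracleTM.init, N, OracleTM.inlined, Option.map_some]
    congr 1
    exact (Sum.elim_update_left ..).trans (congrArg (fun S => Function.update S _ _) (by
      funext k; cases k <;> rfl))
  rw [h₂] at h₁
  obtain ⟨h₃, h₄⟩ := h₁.path (by rintro _ ⟨c, r, k, rfl, hl, -⟩; simp only [emb, hl]; rfl) hc
  refine ⟨h₃.trans ?_, fun hl => ?_⟩
  · simp [hT, Polynomial.eval_comp]
  · obtain ⟨c₁, r, k₁, rfl, hl₁, hc₁⟩ := h₄ hl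
    exact (hM x k₁ c₁ hc₁).2 hl₁

end PromiseHierarchy
namespace PromiseHierarchy

/-! ### Alternating quantification over assignments -/

/-- A string as a function on all positions, with letters `0` outside of the string. -/
def pad {m : ℕ} (x : Fin m → Bool) : ℕ → Bool := fun j => if h : j < m then x ⟨j, h⟩ else false

theorem pad_of_lt {m j : ℕ} (x : Fin m → Bool) (h : j < m) : pad x j = x ⟨j, h⟩ := dif_pos h

theorem pad_val {m : ℕ} (x : Fin m → Bool) (j : Fin m) : pad x j = x j := pad_of_lt x j.2

/-- Alternating quantification over the strings of the lengths `ms` that an assignment takes from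
the `k`-th argument on; the first quantifier is universal if `u` is set. -/
def Alt : (u : Bool) → (ms : List ℕ) → (k : ℕ) → ((ℕ → ℕ → Bool) → Prop) → (ℕ → ℕ → Bool) → Prop
  | _, [], _, Φ, a => Φ a
  | true, m :: ms, k, Φ, a =>
      ∀ x : Fin m → Bool, Alt false ms (k + 1) Φ (Function.update a k (pad x))
  | false, m :: ms, k, Φ, a =>
      ∃ x : Fin m → Bool, Alt true ms (k + 1) Φ (Function.update a k (pad x))

/-- Passes from curried functions to assignments, where the matrix may be any predicate and the
arguments may be renumbered. -/
theorem alt_iff_sat (e : Expr) (ms : List ℕ) (k : ℕ) (a : ℕ → ℕ → Bool) :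
    (Alt false ms k (fun a => e.eval a = true) a ↔ Sat ms (e.toFunFrom ms k a)) ∧
      (Alt true ms k (fun a => e.eval a = true) a ↔ CoSat ms (e.toFunFrom ms k a)) := by
  induction ms generalizing k a with
  | nil =>
    simp only [Alt, Sat, CoSat, Expr.toFunFrom]
    exact ⟨Iff.rfl, Iff.rfl⟩
  | cons m ms ih =>
    constructor
    · simp only [Alt, Sat]
      exact exists_congr fun x => (ih _ _).2
    · simp only [Alt, CoSat]
      exact forall_congr' fun x => (ih _ _).1

theorem Alt.congr {u : Bool} {ms : List ℕ} {k : ℕ} {Φ Ψ : (ℕ → ℕ → Bool) → Prop}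
    {a : ℕ → ℕ → Bool} (h : ∀ a', (∀ i < k, a' i = a i) → (Φ a' ↔ Ψ a')) :
    Alt u ms k Φ a ↔ Alt u ms k Ψ a := by
  induction ms generalizing u k a with
  | nil => exact h a fun _ _ => rfl
  | cons m ms ih =>
    have key : ∀ (u : Bool) (x : Fin m → Bool),
        Alt u ms (k + 1) Φ (Function.update a k (pad x)) ↔
          Alt u ms (k + 1) Ψ (Function.update a k (pad x)) := fun u x => ih fun a' ha' =>
      h a' fun i hi => by rw [ha' i (by omega), Function.update_of_ne (by omega)]
    cases u
    · exact exists_congr (key true)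
    · exact forall_congr' (key false)

theorem alt_not {u : Bool} {ms : List ℕ} {k : ℕ} {Φ : (ℕ → ℕ → Bool) → Prop}
    {a : ℕ → ℕ → Bool} : Alt u ms k (fun a => ¬ Φ a) a ↔ ¬ Alt (!u) ms k Φ a := by
  induction ms generalizing u k a with
  | nil => rfl
  | cons m ms ih => cases u <;> simp [Alt, ih]

/-- A constant can be moved across a quantifier of either kind because there is at least one string
of each length, including length 0. -/
theorem alt_and_left {u : Bool} {ms : List ℕ} {k : ℕ} {c : Prop} {Φ : (ℕ → ℕ → Bool) → Prop}
    {a : ℕ → ℕ → Bool} : Alt u ms k (fun a => c ∧ Φ a) a ↔ c ∧ Alt u ms k Φ a := by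
  induction ms generalizing u k a with
  | nil => rfl
  | cons m ms ih => cases u <;> simp [Alt, ih, forall_and]

theorem alt_or_left {u : Bool} {ms : List ℕ} {k : ℕ} {c : Prop} {Φ : (ℕ → ℕ → Bool) → Prop}
    {a : ℕ → ℕ → Bool} : Alt u ms k (fun a => c ∨ Φ a) a ↔ c ∨ Alt u ms k Φ a := by
  induction ms generalizing u k a with
  | nil => rfl
  | cons m ms ih => cases u <;> simp [Alt, ih, forall_or_left, exists_or]

/-- Two independent alternations can be merged into one: the letters of the first one are put at
the even positions, the letters of the second one at the odd positions of longer strings. -/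
theorem alt_interleave {L : ℕ} {Θ Φ Ψ : (ℕ → ℕ → Bool) → Prop} {u : Bool} {zs ws : List ℕ}
    (hl : ws.length ≤ zs.length) (hzs : ∀ z ∈ zs, 2 * z ≤ L) (hws : ∀ w ∈ ws, 2 * w ≤ L)
    {k : ℕ} {a a₁ a₂ : ℕ → ℕ → Bool}
    (h : ∀ a' a₁' a₂', (∀ i < k, a' i = a i) → (∀ i < k, a₁' i = a₁ i) →
      (∀ i < k + 1, a₂' i = a₂ i) →
      (∀ i j, j < zs.getD i 0 → a' (k + i) (2 * j) = a₁' (k + i) j) →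
      (∀ i j, j < ws.getD i 0 → a' (k + i) (2 * j + 1) = a₂' (k + i + 1) j) →
      (Θ a' ↔ Φ a₁' ∧ Ψ a₂')) :
    Alt u (List.replicate zs.length L) k Θ a ↔ Alt u zs k Φ a₁ ∧ Alt u ws (k + 1) Ψ a₂ := by
  induction zs generalizing u ws k a a₁ a₂ with
  | nil =>
    obtain rfl : ws = [] := by simpa using hl
    exact h a a₁ a₂ (fun _ _ => rfl) (fun _ _ => rfl) (fun _ _ => rfl) (by simp) (by simp)
  | cons z zs ih =>
    have hz : 2 * z ≤ L := hzs z (by simp)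
    cases ws with
    | nil =>
      -- The second alternation is exhausted here; its matrix `Ψ a₂` is carried along as a constant.
      have key : ∀ (u : Bool) (v : Fin L → Bool) (x : Fin z → Bool),
          (∀ j < z, pad v (2 * j) = pad x j) →
          (Alt u (List.replicate zs.length L) (k + 1) Θ (Function.update a k (pad v)) ↔
            Alt u zs (k + 1) Φ (Function.update a₁ k (pad x)) ∧ Ψ a₂) := by
        intro u v x hx
        refine ih (ws := []) (by simp) (fun z hz => hzs z (by simp [hz])) (by simp) ?_
        intro a' a₁' a₂' h₁ h₂ h₃ h₄ h₅
        refine h a' a₁' a₂' ?_ ?_ (fun i hi => h₃ i (by omega)) ?_ (by simp)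
        · intro i hi
          rw [h₁ i (by omega), Function.update_of_ne (by omega)]
        · intro i hi
          rw [h₂ i (by omega), Function.update_of_ne (by omega)]
        · intro i j hj
          cases i with
          | zero => simpa [h₁ k (by omega), h₂ k (by omega)] using hx j (by simpa using hj)
          | succ i =>
            have := h₄ i j (by simpa using hj)
            rwa [show k + (i + 1) = k + 1 + i by omega]
      have hx : ∀ v : Fin L → Bool, ∃ x : Fin z → Bool, ∀ j < z, pad v (2 * j) = pad x j :=
        fun v => ⟨fun j => pad v (2 * j), fun j hj => by rw [pad_of_lt _ hj]⟩
      have hv : ∀ x : Fin z → Bool, ∃ v : Fin L → Bool, ∀ j < z, pad v (2 * j) = pad x j :=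
        fun x => ⟨fun i => pad x (i / 2), fun j hj => by
          rw [pad_of_lt _ (by omega : 2 * j < L)]; simp⟩
      simp only [List.length_cons, List.replicate_succ]
      cases u
      · simp only [Alt]
        constructor
        · rintro ⟨v, h⟩
          obtain ⟨x, hx⟩ := hx v
          obtain ⟨h₁, h₂⟩ := (key true v x hx).1 h
          exact ⟨⟨x, h₁⟩, h₂⟩
        · rintro ⟨⟨x, h₁⟩, h₂⟩
          obtain ⟨v, hx⟩ := hv x
          exact ⟨v, (key true v x hx).2 ⟨h₁, h₂⟩⟩
      · simp only [Alt]
        constructor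
        · intro h
          refine ⟨fun x => ?_, ?_⟩
          · obtain ⟨v, hx⟩ := hv x
            exact ((key false v x hx).1 (h v)).1
          -- Any string would do: the conjunct `Ψ a₂` does not depend on it.
          · obtain ⟨v, hx⟩ := hv fun _ => false
            exact ((key false v _ hx).1 (h v)).2
        · rintro ⟨h₁, h₂⟩ v
          obtain ⟨x, hx⟩ := hx v
          exact (key false v x hx).2 ⟨h₁ x, h₂⟩
    | cons w ws =>
      have hw : 2 * w ≤ L := hws w (by simp)
      have key : ∀ (u : Bool) (v : Fin L → Bool) (x : Fin z → Bool) (y : Fin w → Bool),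
          (∀ j < z, pad v (2 * j) = pad x j) → (∀ j < w, pad v (2 * j + 1) = pad y j) →
          (Alt u (List.replicate zs.length L) (k + 1) Θ (Function.update a k (pad v)) ↔
            Alt u zs (k + 1) Φ (Function.update a₁ k (pad x)) ∧
              Alt u ws (k + 1 + 1) Ψ (Function.update a₂ (k + 1) (pad y))) := by
        intro u v x y hx hy
        refine ih (by simpa using hl) (fun z hz => hzs z (by simp [hz]))
          (fun w hw => hws w (by simp [hw])) ?_
        intro a' a₁' a₂' h₁ h₂ h₃ h₄ h₅
        refine h a' a₁' a₂' ?_ ?_ ?_ ?_ ?_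
        · intro i hi
          rw [h₁ i (by omega), Function.update_of_ne (by omega)]
        · intro i hi
          rw [h₂ i (by omega), Function.update_of_ne (by omega)]
        · intro i hi
          rw [h₃ i (by omega), Function.update_of_ne (by omega)]
        · intro i j hj
          cases i with
          | zero => simpa [h₁ k (by omega), h₂ k (by omega)] using hx j (by simpa using hj)
          | succ i =>
            have := h₄ i j (by simpa using hj)
            rwa [show k + (i + 1) = k + 1 + i by omega]
        · intro i j hj
          cases i with
          | zero =>
            simpa [h₁ k (by omega), h₃ (k + 1) (by omega)] using hy j (by simpa using hj)
          | succ i =>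
            have := h₅ i j (by simpa using hj)
            rwa [show k + (i + 1) = k + 1 + i by omega]
      -- Splitting a string into its two halves and joining two strings into one: with these two
      -- facts a quantifier over `v` is the same as independent quantifiers over `x` and `y`.
      have hx : ∀ v : Fin L → Bool, ∃ (x : Fin z → Bool) (y : Fin w → Bool),
          (∀ j < z, pad v (2 * j) = pad x j) ∧ (∀ j < w, pad v (2 * j + 1) = pad y j) :=
        fun v => ⟨fun j => pad v (2 * j), fun j => pad v (2 * j + 1),
          fun j hj => by rw [pad_of_lt _ hj], fun j hj => by rw [pad_of_lt _ hj]⟩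
      have hv : ∀ (x : Fin z → Bool) (y : Fin w → Bool), ∃ v : Fin L → Bool,
          (∀ j < z, pad v (2 * j) = pad x j) ∧ (∀ j < w, pad v (2 * j + 1) = pad y j) :=
        fun x y => ⟨fun i => if i.1 % 2 = 0 then pad x (i / 2) else pad y (i / 2),
          fun j hj => by rw [pad_of_lt _ (by omega : 2 * j < L)]; simp,
          fun j hj => by
            rw [pad_of_lt _ (by omega : 2 * j + 1 < L)]
            simp only [show (2 * j + 1) % 2 = 1 by omega, show (2 * j + 1) / 2 = j by omega]
            simp⟩
      simp only [List.length_cons, List.replicate_succ]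
      cases u
      · simp only [Alt]
        constructor
        · rintro ⟨v, h⟩
          obtain ⟨x, y, hx, hy⟩ := hx v
          obtain ⟨h₁, h₂⟩ := (key true v x y hx hy).1 h
          exact ⟨⟨x, h₁⟩, ⟨y, h₂⟩⟩
        · rintro ⟨⟨x, h₁⟩, ⟨y, h₂⟩⟩
          obtain ⟨v, hx, hy⟩ := hv x y
          exact ⟨v, (key true v x y hx hy).2 ⟨h₁, h₂⟩⟩
      · simp only [Alt]
        constructor
        · intro h
          refine ⟨fun x => ?_, fun y => ?_⟩
          · obtain ⟨v, hx, hy⟩ := hv x fun _ => false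
            exact ((key false v x _ hx hy).1 (h v)).1
          · obtain ⟨v, hx, hy⟩ := hv (fun _ => false) y
            exact ((key false v _ y hx hy).1 (h v)).2
        · rintro ⟨h₁, h₂⟩ v
          obtain ⟨x, y, hx, hy⟩ := hx v
          exact (key false v x y hx hy).2 ⟨h₁ x, h₂ y⟩

/-! ### Expressions -/

namespace Expr

theorem eval_congr {e : Expr} {ms : List ℕ} (he : e.Scoped ms) {a a' : ℕ → ℕ → Bool}
    (h : ∀ i j, j < ms.getD i 0 → a i j = a' i j) : e.eval a = e.eval a' := by
  induction e with
  | var i j => exact h i j he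
  | not e ih => simp only [eval, ih he]
  | and e₁ e₂ ih₁ ih₂ => simp only [eval, ih₁ he.1, ih₂ he.2]
  | or e₁ e₂ ih₁ ih₂ => simp only [eval, ih₁ he.1, ih₂ he.2]

/-- Rename the variables of an expression. -/
def rename (σ : ℕ → ℕ → ℕ × ℕ) : Expr → Expr
  | var i j => var (σ i j).1 (σ i j).2
  | not e => not (e.rename σ)
  | and e₁ e₂ => and (e₁.rename σ) (e₂.rename σ)
  | or e₁ e₂ => or (e₁.rename σ) (e₂.rename σ)

theorem eval_rename (σ : ℕ → ℕ → ℕ × ℕ) (e : Expr) (a : ℕ → ℕ → Bool) :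
    (e.rename σ).eval a = e.eval fun i j => a (σ i j).1 (σ i j).2 := by
  induction e <;> simp_all [rename, eval]

theorem Scoped.rename {σ : ℕ → ℕ → ℕ × ℕ} {ms ms' : List ℕ}
    (hσ : ∀ i j, j < ms.getD i 0 → (σ i j).2 < ms'.getD (σ i j).1 0) {e : Expr}
    (he : e.Scoped ms) : (e.rename σ).Scoped ms' := by
  induction e with
  | var i j => exact hσ i j he
  | not e ih => exact ih he
  | and e₁ e₂ ih₁ ih₂ => exact ⟨ih₁ he.1, ih₂ he.2⟩
  | or e₁ e₂ ih₁ ih₂ => exact ⟨ih₁ he.1, ih₂ he.2⟩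

/-- An expression for the equivalence of two expressions. -/
def iff (e₁ e₂ : Expr) : Expr := or (and e₁ e₂) (and (not e₁) (not e₂))

theorem eval_iff {e₁ e₂ : Expr} {a : ℕ → ℕ → Bool} :
    (e₁.iff e₂).eval a = (e₁.eval a == e₂.eval a) := by
  simp only [iff, eval]
  cases e₁.eval a <;> cases e₂.eval a <;> rfl

end Expr

/-! ### Comparison of strings -/

/-- The number with the binary digits `y 0, …, y (m - 1)`. -/
def binary (y : ℕ → Bool) : ℕ → ℕ
  | 0 => 0
  | m + 1 => 2 * binary y m + (y m).toNat

theorem binary_inj {y z : ℕ → Bool} {m : ℕ} (h : binary y m = binary z m) :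
    ∀ j < m, y j = z j := by
  induction m with
  | zero => simp
  | succ m ih =>
    simp only [binary] at h
    have h₁ := Bool.toNat_lt (y m)
    have h₂ := Bool.toNat_lt (z m)
    have h₃ : y m = z m := by
      cases hy : y m <;> cases hz : z m <;> simp [hy, hz] at h ⊢ <;> omega
    intro j hj
    rcases Nat.lt_succ_iff_lt_or_eq.1 hj with hj | rfl
    · exact ih (by omega) j hj
    · exact h₃

theorem binary_congr {y z : ℕ → Bool} {m : ℕ} (h : ∀ j < m, y j = z j) :
    binary y m = binary z m := by
  induction m with
  | zero => rfl
  | succ m ih => simp only [binary, ih fun j hj => h j (by omega), h m (by omega)]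

end PromiseHierarchy
namespace PromiseHierarchy

/-! ### A formula with exactly one solution over each string -/

/-- The position of a variable in the formula that makes use of the counterexample `y`: the first
argument now has the letters `b`, `t`, `x`, `y`, and the letters of the later arguments stand at odd
positions of the arguments before them. -/
def oddRenaming (m₁ : ℕ) : ℕ → ℕ → ℕ × ℕ
  | 0, j => (0, 2 + j)
  | 1, j => (0, 2 + m₁ + j)
  | i + 2, j => (i + 1, 2 * j + 1)

/-- The position of a variable in the formula that quantifies over all strings: the letters of the
later arguments stand at even positions. -/
def evenRenaming : ℕ → ℕ → ℕ × ℕ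
  | 0, j => (0, 2 + j)
  | i + 1, j => (i + 1, 2 * j)

namespace Expr

/-- `geIter m₁ m e` says that the string `z` at the even positions of the second argument is greater
than `y` in the lexicographic order, or it is equal to `y` and `e` holds. -/
def geIter (m₁ : ℕ) : ℕ → Expr → Expr
  | 0, e => e
  | m + 1, e => geIter m₁ m
      (or (and (var 1 (2 * m)) (not (var 0 (2 + m₁ + m))))
        (and (or (var 1 (2 * m)) (not (var 0 (2 + m₁ + m)))) e))

/-- `zeroIter m₁ m e` says that `e` holds and that `y` is zero if `t` is set. -/
def zeroIter (m₁ : ℕ) : ℕ → Expr → Expr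
  | 0, e => e
  | m + 1, e => zeroIter m₁ m (and (or (not (var 0 1)) (not (var 0 (2 + m₁ + m)))) e)

/-- The formula that, for each `x`, has exactly one solution `(t, y)`: if `f` is accepted at
`x` then `t = 1` and `y = 0`, otherwise `t = 0` and `y` is the least counterexample. -/
def core (m₁ m₂ : ℕ) (f : Expr) : Expr :=
  zeroIter m₁ m₂ (and
    (or (and (not (var 0 1)) (geIter m₁ m₂ (not (var 0 1)))) (f.rename evenRenaming))
    (or (var 0 1) (not (f.rename (oddRenaming m₁)))))

/-- Digit `0` is the most significant one. The comparison of digit `m` is placed innermost, where it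
matters only if all earlier digits agree. -/
theorem eval_geIter (m₁ m : ℕ) (e : Expr) (a : ℕ → ℕ → Bool) :
    (geIter m₁ m e).eval a = true ↔
      binary (fun j => a 0 (2 + m₁ + j)) m < binary (fun j => a 1 (2 * j)) m ∨
        binary (fun j => a 0 (2 + m₁ + j)) m = binary (fun j => a 1 (2 * j)) m ∧
          e.eval a = true := by
  induction m generalizing e with
  | zero => simp [geIter, binary]
  | succ m ih =>
    rw [geIter, ih]
    simp only [eval, binary]
    cases a 0 (2 + m₁ + m) <;> cases a 1 (2 * m) <;> cases e.eval a <;> simp <;> omega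

theorem eval_zeroIter (m₁ m : ℕ) (e : Expr) (a : ℕ → ℕ → Bool) :
    (zeroIter m₁ m e).eval a = true ↔
      (a 0 1 = true → ∀ j < m, a 0 (2 + m₁ + j) = false) ∧ e.eval a = true := by
  induction m generalizing e with
  | zero => simp [zeroIter]
  | succ m ih =>
    rw [zeroIter, ih]
    simp only [eval, Nat.forall_lt_succ_right]
    cases a 0 1 <;> cases a 0 (2 + m₁ + m) <;> cases e.eval a <;> simp

/-- `Expr` has no constants. The innermost expression `¬ t` of `geIter` in `core` plays the part of
"true", since it stands in conjunction with `¬ t`; this yields `≤` in place of `<`. -/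
theorem eval_core (m₁ m₂ : ℕ) (f : Expr) (a : ℕ → ℕ → Bool) :
    (core m₁ m₂ f).eval a = true ↔
      (a 0 1 = true → ∀ j < m₂, a 0 (2 + m₁ + j) = false) ∧
        (a 0 1 = true ∨ ¬ (f.rename (oddRenaming m₁)).eval a = true) ∧
          ((a 0 1 = false ∧
            binary (fun j => a 0 (2 + m₁ + j)) m₂ ≤ binary (fun j => a 1 (2 * j)) m₂) ∨
              (f.rename evenRenaming).eval a = true) := by
  rw [core, eval_zeroIter, le_iff_lt_or_eq]
  simp only [eval, Bool.and_eq_true, Bool.or_eq_true, Bool.not_eq_true', eval_geIter,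
    Bool.not_eq_true]
  tauto

theorem Scoped.geIter {m₁ m : ℕ} {e : Expr} {ms : List ℕ} (h₁ : 2 + m₁ + m ≤ ms.getD 0 0)
    (h₂ : 2 * m ≤ ms.getD 1 0) (he : e.Scoped ms) : (e.geIter m₁ m).Scoped ms := by
  induction m generalizing e with
  | zero => exact he
  | succ m ih =>
    refine ih (by omega) (by omega) ?_
    simp only [Scoped]
    refine ⟨⟨?_, ?_⟩, ⟨?_, ?_⟩, he⟩ <;> omega

theorem Scoped.zeroIter {m₁ m : ℕ} {e : Expr} {ms : List ℕ} (h₁ : 2 + m₁ + m ≤ ms.getD 0 0)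
    (he : e.Scoped ms) : (e.zeroIter m₁ m).Scoped ms := by
  induction m generalizing e with
  | zero => exact he
  | succ m ih =>
    refine ih (by omega) ?_
    simp only [Scoped]
    refine ⟨⟨?_, ?_⟩, he⟩ <;> omega

end Expr

theorem getD_le_sum (l : List ℕ) (i : ℕ) : l.getD i 0 ≤ l.sum := by
  by_cases h : i < l.length
  · rw [List.getD_eq_getElem _ _ h]
    exact List.le_sum_of_mem (List.getElem_mem h)
  · rw [List.getD_eq_default _ _ (not_lt.1 h)]
    exact Nat.zero_le _

/-- The lengths of the arguments of the new formula. -/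
def liftLengths (m₁ : ℕ) (rest : List ℕ) : List ℕ :=
  (2 + m₁ + rest.headD 0) :: List.replicate rest.length (2 * rest.sum)

/-- Serves both renamings: `i' = i` for the even positions, and `i' = i + 1` for the odd ones, where
each argument moves up by one place. The common length `2 * rest.sum` has room for any two
interleaved arguments. -/
theorem liftLengths_getD_succ {m₁ : ℕ} {rest : List ℕ} {i i' j : ℕ} (hi : i ≤ i')
    (h : j < rest.getD i' 0) : 2 * j + 1 < (liftLengths m₁ rest).getD (i + 1) 0 := by
  have hi : i < rest.length := by
    by_contra hi
    rw [List.getD_eq_default _ _ (by omega)] at h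
    omega
  have := getD_le_sum rest i'
  rw [liftLengths, List.getD_cons_succ, List.getD_eq_getElem _ _ (by simpa using hi)]
  simp only [List.getElem_replicate]
  omega

theorem Expr.Scoped.core {m₁ : ℕ} {rest : List ℕ} {f : Expr} (hf : f.Scoped (m₁ :: rest)) :
    (f.core m₁ (rest.headD 0)).Scoped (liftLengths m₁ rest) := by
  have h₀ : (liftLengths m₁ rest).getD 0 0 = 2 + m₁ + rest.headD 0 := rfl
  have ht : (var 0 1).Scoped (liftLengths m₁ rest) := by
    simp only [Scoped, h₀]
    omega
  refine .zeroIter h₀.ge ⟨⟨⟨ht, .geIter h₀.ge ?_ ht⟩, ?_⟩, ht, ?_⟩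
  · cases rest with
    | nil => simp
    | cons m ms => simp [liftLengths, List.replicate_succ]
  · refine hf.rename fun i j hj => ?_
    cases i with
    | zero =>
      simp only [evenRenaming, h₀]
      simp only [List.getD_cons_zero] at hj
      omega
    | succ i =>
      have := liftLengths_getD_succ (m₁ := m₁) le_rfl (by rwa [List.getD_cons_succ] at hj)
      simp only [evenRenaming]
      omega
  · refine hf.rename fun i j hj => ?_
    match i with
    | 0 =>
      simp only [oddRenaming, h₀]
      simp only [List.getD_cons_zero] at hj
      omega
    | 1 =>
      simp only [oddRenaming, h₀]
      cases rest with
      | nil => simp at hj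
      | cons m ms => simp at hj ⊢; omega
    | i + 2 =>
      simp only [oddRenaming]
      exact liftLengths_getD_succ (Nat.le_succ i) (by rwa [List.getD_cons_succ] at hj)

/-- The conditions that `core` imposes on `(t, y)` at a fixed `x`, where `D` is the set of the
strings that are not counterexamples. -/
def ValidPair {m : ℕ} (D : (Fin m → Bool) → Prop) (t : Bool) (y : Fin m → Bool) : Prop :=
  (t = true → ∀ j, y j = false) ∧ (t = true ∨ ¬ D y) ∧
    ∀ z : Fin m → Bool, (t = false ∧ binary (pad y) m ≤ binary (pad z) m) ∨ D z

/-- If all strings lie in `D`, then `t = 0` would require a counterexample, so `t = 1`, and this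
forces `y = 0`. Otherwise the third condition at a counterexample excludes `t = 1` and makes `y`
minimal; the minimal counterexample is unique because `binary` is injective on strings of one
length. -/
theorem exists_validPair_iff {m : ℕ} (D : (Fin m → Bool) → Prop) :
    ∃ t₀ y₀, (t₀ = true ↔ ∀ y, D y) ∧ ∀ t y, ValidPair D t y ↔ t = t₀ ∧ y = y₀ := by
  classical
  by_cases hD : ∀ y, D y
  · refine ⟨true, fun _ => false, by simpa using hD, fun t y => ⟨?_, ?_⟩⟩
    · rintro ⟨h₁, h₂, -⟩
      have ht := h₂.resolve_right (not_not.2 (hD y))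
      exact ⟨ht, funext (h₁ ht)⟩
    · rintro ⟨rfl, rfl⟩
      exact ⟨fun _ _ => rfl, .inl rfl, fun z => .inr (hD z)⟩
  · have hne : ∃ y, ¬ D y := not_forall.1 hD
    obtain ⟨y₀, hy₀, hmin⟩ : ∃ y₀, ¬ D y₀ ∧ ∀ z, ¬ D z → binary (pad y₀) m ≤ binary (pad z) m := by
      have := exists_minimalFor_of_wellFoundedLT (fun y => ¬ D y) (fun y => binary (pad y) m) hne
      obtain ⟨y₀, h₁, h₂⟩ := this
      refine ⟨y₀, h₁, fun z hz => ?_⟩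
      by_contra hlt
      exact hlt (h₂ hz (le_of_not_ge hlt))
    refine ⟨false, y₀, by simpa using hne, fun t y => ⟨?_, ?_⟩⟩
    · rintro ⟨h₁, h₂, h₃⟩
      have h₄ := (h₃ y₀).resolve_right hy₀
      refine ⟨h₄.1, funext fun j => ?_⟩
      have h₅ := hmin y (h₂.resolve_left (by simp [h₄.1]))
      have := binary_inj (le_antisymm h₄.2 h₅) j j.2
      rwa [pad_val, pad_val] at this
    · rintro ⟨rfl, rfl⟩
      refine ⟨by simp, .inr hy₀, fun z => ?_⟩
      by_cases hz : D z
      · exact .inr hz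
      · exact .inl ⟨rfl, hmin z hz⟩

end PromiseHierarchy
-- Solutions of the lifted instances
namespace PromiseHierarchy

/-- Makes level 1 uniform with the others: a missing second argument is treated as an empty string,
whose padding is constantly `false`, so that the update changes nothing. -/
theorem alt_second {rest : List ℕ} {Φ : (ℕ → ℕ → Bool) → Prop} {a : ℕ → ℕ → Bool}
    (ha : a 1 = fun _ => false) : Alt true rest 1 Φ a ↔
      ∀ z : Fin (rest.headD 0) → Bool, Alt false rest.tail 2 Φ (Function.update a 1 (pad z)) := by
  cases rest with
  | nil =>
    have key : ∀ z : Fin (([] : List ℕ).headD 0) → Bool, Function.update a 1 (pad z) = a :=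
      fun z => Function.update_eq_iff.2 ⟨by rw [ha]; rfl, fun _ _ => rfl⟩
    exact ⟨fun h z => by rw [key z]; exact h, fun h => by
      have := h fun _ => false
      rw [key] at this
      exact this⟩
  | cons m ms => exact Iff.rfl

namespace Instance

variable {n : ℕ} (I : Instance n)

/-- The length of the second argument, if there is one. -/
abbrev second : ℕ := I.rest.headD 0

/-- The strings `y` that are no counterexamples for `x`. -/
def Passes (x : Fin I.first → Bool) (y : Fin I.second → Bool) : Prop :=
  Alt false I.rest.tail 2 (fun a => I.expr.eval a = true)
    (Function.update (Function.update (fun _ _ => false) 0 (pad x)) 1 (pad y))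

theorem mem_solutions_iff_passes (x : Fin I.first → Bool) :
    x ∈ solutions I.fn ↔ ∀ y, I.Passes x y := by
  have h : x ∈ solutions I.fn ↔ Alt true I.rest 1 (fun a => I.expr.eval a = true)
      (Function.update (fun _ _ => false) 0 (pad x)) :=
    ((alt_iff_sat I.expr I.rest 1 (Function.update (fun _ _ => false) 0 (pad x))).2).symm
  rw [h]
  exact alt_second rfl

/-- The instance with an expression over the lengthened arguments. -/
def lift (E : Expr) (hE : E.Scoped (liftLengths I.first I.rest)) : Instance n where
  first := 2 + I.first + I.second
  rest := List.replicate I.rest.length (2 * I.rest.sum)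
  expr := E
  first_pos := by omega
  level := by simpa using I.level
  expr_scoped := hE

/-- The letters of the first argument that stand for `x`. -/
def xPart (v : Fin (2 + I.first + I.second) → Bool) : Fin I.first → Bool :=
  fun j => pad v (2 + j)

/-- The letters of the first argument that stand for `y`. -/
def yPart (v : Fin (2 + I.first + I.second) → Bool) : Fin I.second → Bool :=
  fun j => pad v (2 + I.first + j)

theorem pad_xPart (v : Fin (2 + I.first + I.second) → Bool) {j : ℕ} (hj : j < I.first) :
    pad (I.xPart v) j = pad v (2 + j) := pad_of_lt _ hj

theorem pad_yPart (v : Fin (2 + I.first + I.second) → Bool) {j : ℕ} (hj : j < I.second) :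
    pad (I.yPart v) j = pad v (2 + I.first + j) := pad_of_lt _ hj

/-- The first argument with the parts `b`, `t`, `x` and `y`. -/
def glue (b t : Bool) (x : Fin I.first → Bool) (y : Fin I.second → Bool) :
    Fin (2 + I.first + I.second) → Bool := fun i =>
  if i.1 = 0 then b else if i.1 = 1 then t else
    if i.1 < 2 + I.first then pad x (i - 2) else pad y (i - (2 + I.first))

theorem glue_parts (b t : Bool) (x : Fin I.first → Bool) (y : Fin I.second → Bool) :
    pad (I.glue b t x y) 0 = b ∧ pad (I.glue b t x y) 1 = t ∧
      I.xPart (I.glue b t x y) = x ∧ I.yPart (I.glue b t x y) = y := by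
  refine ⟨?_, ?_, funext fun j => ?_, funext fun j => ?_⟩
  · rw [pad_of_lt _ (by omega)]; simp [glue]
  · rw [pad_of_lt _ (by omega)]; simp [glue]
  · have := j.2
    rw [xPart, pad_of_lt _ (by omega)]
    simp [glue, pad_val, show 2 + j.1 ≠ 1 by omega]
  · have := j.2
    rw [yPart, pad_of_lt _ (by omega)]
    simp [glue, pad_val, show 2 + I.first + j.1 ≠ 1 by omega]

theorem glue_eta (v : Fin (2 + I.first + I.second) → Bool) :
    v = I.glue (pad v 0) (pad v 1) (I.xPart v) (I.yPart v) := by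
  funext i
  rw [glue]
  have := i.2
  split_ifs with h₀ h₁ h₂
  · rw [← h₀, pad_val]
  · rw [← h₁, pad_val]
  · rw [pad_xPart _ _ (by omega), show 2 + (i.1 - 2) = i.1 by omega, pad_val]
  · rw [pad_yPart _ _ (by omega), show 2 + I.first + (i.1 - (2 + I.first)) = i.1 by omega, pad_val]

/-- All queries have the form `P ∧ core` with `P` a condition on the first argument alone. Such a
`P` passes the quantifiers, and what remains splits into the alternation over `z` and the one that
refutes `y`. -/
theorem mem_solutions_lift (E : Expr) (hE : E.Scoped (liftLengths I.first I.rest))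
    (P : (ℕ → Bool) → Prop) (hP : ∀ a, E.eval a = true ↔
      P (a 0) ∧ (I.expr.core I.first I.second).eval a = true)
    (v : Fin (2 + I.first + I.second) → Bool) :
    v ∈ solutions (I.lift E hE).fn ↔
      P (pad v) ∧ ValidPair (I.Passes (I.xPart v)) (pad v 1) (I.yPart v) := by
  have h₀ : v ∈ solutions (I.lift E hE).fn ↔
      Alt true (List.replicate I.rest.length (2 * I.rest.sum)) 1 (fun a => E.eval a = true)
        (Function.update (fun _ _ => false) 0 (pad v)) :=
    ((alt_iff_sat E _ 1 (Function.update (fun _ _ => false) 0 (pad v))).2).symm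
  set x := I.xPart v with hx
  set y := I.yPart v with hy
  set a₁ : ℕ → ℕ → Bool := Function.update (fun _ _ => false) 0 (pad x) with ha₁
  set a₂ : ℕ → ℕ → Bool := Function.update a₁ 1 (pad y) with ha₂
  set Φ : (ℕ → ℕ → Bool) → Prop := fun a =>
    (pad v 1 = false ∧ binary (pad y) I.second ≤ binary (a 1) I.second) ∨
      I.expr.eval a = true with hΦ
  set Z : Prop := pad v 1 = true → ∀ j, y j = false with hZ
  set Ψ : (ℕ → ℕ → Bool) → Prop := fun a =>
    (P (pad v) ∧ Z) ∧ (pad v 1 = true ∨ ¬ I.expr.eval a = true) with hΨ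
  have hmain : Alt true (List.replicate I.rest.length (2 * I.rest.sum)) 1
      (fun a => E.eval a = true) (Function.update (fun _ _ => false) 0 (pad v)) ↔
      -- In `a₂` the second argument is already fixed to `y`, so its alternation starts one argument
      -- later. Negation of the matrix turns the quantifier `∃` found there into `∀`, which is why
      -- both alternations begin with the same kind.
      Alt true I.rest 1 Φ a₁ ∧ Alt true I.rest.tail 2 Ψ a₂ := by
    refine alt_interleave (by simp)
      (fun z hz => Nat.mul_le_mul_left 2 (List.le_sum_of_mem hz))
      (fun z hz => Nat.mul_le_mul_left 2 (List.le_sum_of_mem (List.mem_of_mem_tail hz))) ?_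
    intro a' a₁' a₂' h₁ h₂ h₃ h₄ h₅
    have e₀ : a' 0 = pad v := by rw [h₁ 0 (by omega), Function.update_self]
    have e₁ : a₁' 0 = pad x := by rw [h₂ 0 (by omega), ha₁, Function.update_self]
    have e₂ : a₂' 0 = pad x := by
      rw [h₃ 0 (by omega), ha₂, Function.update_of_ne (by omega), ha₁, Function.update_self]
    have e₃ : a₂' 1 = pad y := by rw [h₃ 1 (by omega), ha₂, Function.update_self]
    have hev : (I.expr.rename evenRenaming).eval a' = I.expr.eval a₁' := by
      rw [Expr.eval_rename]
      refine Expr.eval_congr I.expr_scoped fun i j hj => ?_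
      cases i with
      | zero => simp only [evenRenaming, e₀, e₁]; exact (I.pad_xPart v hj).symm
      | succ i =>
        have := h₄ i j (by simpa using hj)
        rwa [Nat.add_comm 1 i] at this
    have hodd : (I.expr.rename (oddRenaming I.first)).eval a' = I.expr.eval a₂' := by
      rw [Expr.eval_rename]
      refine Expr.eval_congr I.expr_scoped fun i j hj => ?_
      match i with
      | 0 => simp only [oddRenaming, e₀, e₂]; exact (I.pad_xPart v hj).symm
      | 1 =>
        simp only [oddRenaming, e₀, e₃]
        exact (I.pad_yPart v (by cases hr : I.rest <;> simp_all)).symm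
      | i + 2 =>
        have := h₅ i j (by
          rw [List.getD_cons_succ] at hj
          cases hr : I.rest with
          | nil => simp [hr] at hj
          | cons m ms => rw [hr, List.getD_cons_succ] at hj; exact hj)
        rwa [Nat.add_comm 1 i] at this
    have hb₁ : binary (fun j => pad v (2 + I.first + j)) I.second = binary (pad y) I.second :=
      binary_congr fun j hj => (I.pad_yPart v hj).symm
    have hb₂ : binary (fun j => a' 1 (2 * j)) I.second = binary (a₁' 1) I.second :=
      binary_congr fun j hj => h₄ 0 j (by cases hr : I.rest <;> simp_all)
    have hz : (pad v 1 = true → ∀ j < I.second, pad v (2 + I.first + j) = false) ↔ Z :=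
      imp_congr_right fun _ => ⟨fun h j => h j j.2, fun h j hj => h ⟨j, hj⟩⟩
    rw [hP, Expr.eval_core, e₀, hz, hb₁, hb₂, hev, hodd]
    exact ⟨fun ⟨h₁, h₂, h₃, h₄⟩ => ⟨h₄, ⟨h₁, h₂⟩, h₃⟩, fun ⟨h₁, ⟨h₂, h₃⟩, h₄⟩ => ⟨h₂, h₃, h₄, h₁⟩⟩
  have hA : Alt true I.rest 1 Φ a₁ ↔ ∀ z : Fin I.second → Bool,
      (pad v 1 = false ∧ binary (pad y) I.second ≤ binary (pad z) I.second) ∨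
        I.Passes x z := by
    rw [alt_second (by rw [ha₁, Function.update_of_ne (by omega)])]
    refine forall_congr' fun z => ?_
    rw [Alt.congr (Ψ := fun a => (pad v 1 = false ∧
      binary (pad y) I.second ≤ binary (pad z) I.second) ∨ I.expr.eval a = true), alt_or_left]
    · rfl
    · intro a' ha'
      simp only [hΦ, ha' 1 (by omega), Function.update_self]
  have hB : Alt true I.rest.tail 2 Ψ a₂ ↔
      (P (pad v) ∧ Z) ∧ (pad v 1 = true ∨ ¬ I.Passes x y) := by
    rw [hΨ, alt_and_left, alt_or_left, alt_not]
    rfl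
  rw [h₀, hmain, hA, hB]
  exact ⟨fun ⟨h₁, h₂, h₃⟩ => ⟨h₂.1, h₂.2, h₃, h₁⟩, fun ⟨h₁, h₂, h₃, h₄⟩ => ⟨h₄, ⟨h₁, h₂⟩, h₃⟩⟩

end Instance

end PromiseHierarchy
-- The queries to `UVAL`: search for the solution and final test
namespace PromiseHierarchy

namespace Expr

/-- The formula whose unique solution starts with the letter `j` of the solution of `f`. -/
def searchQuery (j : ℕ) (G : Expr) : Expr :=
  and (and (var 0 1) (iff (var 0 0) (var 0 (2 + j)))) G

/-- The formula whose unique solution tells whether the string found is a solution of `f`. -/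
def finalQuery (G : Expr) : Expr := and (iff (var 0 0) (var 0 1)) G

/-- The literal that says that the letter `j` of `x` is `y`. -/
def literal (j : ℕ) : Bool → Expr
  | true => var 0 (2 + j)
  | false => not (var 0 (2 + j))

end Expr

namespace Instance

variable {n : ℕ} (I : Instance n)

/-- `G` restricts the formula `core` to the strings `x` that agree with `c` from position `i` on,
where `c` agrees with the solution if it is unique. -/
structure IsPartial (c : ℕ → Bool) (i : ℕ) (G : Expr) : Prop where
  scope : G.Scoped (liftLengths I.first I.rest)
  eval_iff : ∀ a, G.eval a = true ↔ (∀ j < I.first, i ≤ j → a 0 (2 + j) = c j) ∧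
    (I.expr.core I.first I.second).eval a = true
  agrees : (solutions I.fn).encard ≤ 1 → ∀ x ∈ solutions I.fn, ∀ j < I.first, i ≤ j → c j = pad x j

variable {I}

theorem scoped_var {j : ℕ} (h : j < 2 + I.first) :
    (Expr.var 0 j).Scoped (liftLengths I.first I.rest) := by
  simp only [Expr.Scoped, liftLengths, List.getD_cons_zero]
  omega

theorem isPartial_core : I.IsPartial (fun _ => false) I.first (I.expr.core I.first I.second) where
  scope := I.expr_scoped.core
  eval_iff a := ⟨fun h => ⟨fun j h₁ h₂ => by omega, h⟩, And.right⟩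
  -- No position is fixed yet; the search runs from the last letter down to the first.
  agrees _ x _ j h₁ h₂ := by omega

variable {c : ℕ → Bool} {i : ℕ} {G : Expr}

theorem IsPartial.scoped_searchQuery (h : I.IsPartial c i G) {j : ℕ} (hj : j < I.first) :
    (Expr.searchQuery j G).Scoped (liftLengths I.first I.rest) := by
  have h₀ : (Expr.var 0 0).Scoped (liftLengths I.first I.rest) := scoped_var (by omega)
  have h₁ : (Expr.var 0 (2 + j)).Scoped (liftLengths I.first I.rest) := scoped_var (by omega)
  exact ⟨⟨scoped_var (by omega), ⟨h₀, h₁⟩, h₀, h₁⟩, h.scope⟩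

theorem IsPartial.scoped_finalQuery (h : I.IsPartial c i G) :
    (Expr.finalQuery G).Scoped (liftLengths I.first I.rest) := by
  have h₀ : (Expr.var 0 0).Scoped (liftLengths I.first I.rest) := scoped_var (by omega)
  have h₁ : (Expr.var 0 1).Scoped (liftLengths I.first I.rest) := scoped_var (by omega)
  exact ⟨⟨⟨h₀, h₁⟩, h₀, h₁⟩, h.scope⟩

/-- If the lifted instance has exactly one solution, then its answer is the first letter. -/
theorem eq_of_mem_UVAL_lift {E : Expr} {hE : E.Scoped (liftLengths I.first I.rest)}
    {b t : Bool} {x : Fin I.first → Bool} {y : Fin I.second → Bool}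
    (h : ∀ v : Fin (2 + I.first + I.second) → Bool,
      v ∈ solutions (I.lift E hE).fn ↔ v = I.glue b t x y) {a : Bool}
    (ha : a ∈ (UVAL n (I.lift E hE).encode).1) : a = b := by
  obtain ⟨v, hv, rfl⟩ := ha (I.lift E hE) rfl ⟨_, (h _).2 rfl, fun w hw => (h w).1 hw⟩
  have h₁ := (I.glue_parts b t x y).1
  rw [pad_of_lt _ (by omega)] at h₁
  exact (congrFun ((h v).1 hv) _).trans h₁

/-- If `x` is the unique solution of `f`, then `t = 1` leaves only `x`, the pair `(t, y₀)` is
determined by `x`, and `b` is its letter `i`; the query keeps the promise. If `f` has no solution or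
several, nothing is claimed about the answer, and `agrees` holds vacuously. -/
theorem IsPartial.literal (h : I.IsPartial c (i + 1) G) (hi : i < I.first) {y : Bool}
    (hy : y ∈ (UVAL n (I.lift _ (h.scoped_searchQuery hi)).encode).1) :
    I.IsPartial (Function.update c i y) i (.and (.literal i y) G) where
  scope := by
    refine ⟨?_, h.scope⟩
    cases y <;> exact scoped_var (by omega)
  eval_iff a := by
    have hl : (Expr.literal i y).eval a = true ↔ a 0 (2 + i) = y := by
      cases y <;> simp [Expr.literal, Expr.eval]
    rw [Expr.eval, Bool.and_eq_true, hl, h.eval_iff, ← and_assoc]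
    refine and_congr_left' ⟨fun ⟨h₁, h₂⟩ j hj hij => ?_, fun h₁ => ⟨?_, fun j hj hij => ?_⟩⟩
    · rcases eq_or_lt_of_le hij with rfl | hij
      · rw [h₁, Function.update_self]
      · rw [Function.update_of_ne (by omega), h₂ j hj hij]
    · rw [h₁ i hi le_rfl, Function.update_self]
    · rw [h₁ j hj (by omega), Function.update_of_ne (by omega)]
  agrees hle x hx := by
    have huniq : ∀ x' ∈ solutions I.fn, x' = x := fun x' hx' =>
      Set.encard_le_one_iff.1 hle x' x hx' hx
    obtain ⟨t₀, y₀, ht₀, hval⟩ := exists_validPair_iff (I.Passes x)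
    have ht : t₀ = true := ht₀.2 ((I.mem_solutions_iff_passes x).1 hx)
    subst ht
    have key : y = pad x i := by
      refine eq_of_mem_UVAL_lift (b := pad x i) (t := true) (x := x) (y := y₀) (fun v => ?_) hy
      refine (I.mem_solutions_lift _ _ (fun α => (α 1 = true ∧ α 0 = α (2 + i)) ∧
        ∀ j < I.first, i + 1 ≤ j → α (2 + j) = c j) (fun a => by
          simp only [Expr.searchQuery, Expr.eval, Bool.and_eq_true, h.eval_iff, Expr.eval_iff,
            beq_iff_eq, and_assoc]) v).trans ?_
      constructor
      · rintro ⟨⟨⟨h₁, h₂⟩, h₃⟩, h₄⟩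
        -- A valid pair with `t = 1` certifies that the `x`-part is a solution of `f`.
        have hx' : I.xPart v = x := by
          obtain ⟨t₁, y₁, ht₁, hval₁⟩ := exists_validPair_iff (I.Passes (I.xPart v))
          refine huniq _ ((I.mem_solutions_iff_passes _).2 (ht₁.1 ?_))
          rw [← ((hval₁ _ _).1 h₄).1, h₁]
        rw [hx', hval] at h₄
        rw [I.glue_eta v, h₂, h₄.1, h₄.2, ← I.pad_xPart v hi, hx']
      · rintro rfl
        obtain ⟨h₁, h₂, h₃, h₄⟩ := I.glue_parts (pad x i) true x y₀
        refine ⟨⟨⟨h₂, ?_⟩, fun j hj hij => ?_⟩, ?_⟩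
        · rw [h₁, ← I.pad_xPart _ hi, h₃]
        · rw [← I.pad_xPart _ hj, h₃]
          exact (h.agrees hle x hx j hj hij).symm
        · rw [h₂, h₃, h₄]
          exact (hval _ _).2 ⟨rfl, rfl⟩
    intro j hj hij
    rcases eq_or_lt_of_le hij with rfl | hij
    · rw [Function.update_self, key]
    · rw [Function.update_of_ne (by omega)]
      exact h.agrees hle x hx j hj hij

/-- With all of `x` fixed, the valid pair exists and is unique whether or not `x` is a solution, so
the promise of `UVAL` always holds and the answer is `t`. If there is a solution, `agrees`
identifies it with `x`; hence testing `x` decides `Sat`. -/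
theorem IsPartial.mem_USAT (h : I.IsPartial c 0 G) {y : Bool}
    (hy : y ∈ (UVAL n (I.lift _ h.scoped_finalQuery).encode).1) : y ∈ usatAnswers I.fn := by
  intro hle
  set x : Fin I.first → Bool := fun j => c j with hx
  obtain ⟨t₀, y₀, ht₀, hval⟩ := exists_validPair_iff (I.Passes x)
  have key : y = t₀ := by
    refine eq_of_mem_UVAL_lift (b := t₀) (t := t₀) (x := x) (y := y₀) (fun v => ?_) hy
    refine (I.mem_solutions_lift _ _ (fun α => α 0 = α 1 ∧
      ∀ j < I.first, 0 ≤ j → α (2 + j) = c j) (fun a => by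
        simp only [Expr.finalQuery, Expr.eval, Bool.and_eq_true, h.eval_iff, Expr.eval_iff,
          beq_iff_eq, and_assoc]) v).trans ?_
    constructor
    · rintro ⟨⟨h₁, h₂⟩, h₃⟩
      have hx' : I.xPart v = x := funext fun j => h₂ j j.2 (Nat.zero_le _)
      rw [hx', hval] at h₃
      rw [I.glue_eta v, h₁, h₃.1, h₃.2, hx']
    · rintro rfl
      obtain ⟨h₁, h₂, h₃, h₄⟩ := I.glue_parts t₀ t₀ x y₀
      refine ⟨⟨by rw [h₁, h₂], fun j hj _ => ?_⟩, ?_⟩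
      · rw [← I.pad_xPart _ hj, h₃, pad_of_lt _ hj]
      · rw [h₂, h₃, h₄]
        exact (hval _ _).2 ⟨rfl, rfl⟩
  have hsat : Sat (I.first :: I.rest) I.fn ↔ ∃ x, x ∈ solutions I.fn := by
    rw [Sat]; rfl
  show y = true ↔ _
  rw [hsat, key, ht₀, ← I.mem_solutions_iff_passes]
  refine ⟨fun h => ⟨x, h⟩, fun ⟨x', hx'⟩ => ?_⟩
  have : x = x' := funext fun j => by
    rw [hx, ← pad_val x' j]
    exact h.agrees hle x' hx' j j.2 (Nat.zero_le _)
  rwa [this]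

end Instance

end PromiseHierarchy
-- Basic programs: copying, writing and reading on stacks
namespace PromiseHierarchy

namespace Prog

variable {K : Type} [DecidableEq K] {χ : PromiseProblem} {qry : K} {S : K → List Bool}
  {R : (K → List Bool) → Prop}

/-- The postcondition of `p` is the whole claim about `q`, so that no intermediate assertion has to
be named. -/
theorem must_seq {p q : Prog K} {t u : ℕ}
    (h : Must χ qry p S t fun S' => Must χ qry q S' u R) : Must χ qry (seq p q) S (t + u) R :=
  .seq h fun _ => id

theorem must_le {p : Prog K} {t u : ℕ} (h : Must χ qry p S t R) (htu : t ≤ u) :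
    Must χ qry p S u R :=
  .mono h htu fun _ => id

/-- Put a word on top of a stack. -/
def prepend (k : K) : List Bool → Prog K
  | [] => skip
  | b :: w => seq (prepend k w) (push k b)

theorem must_prepend {k : K} {w : List Bool} (h : R (Function.update S k (w ++ S k))) :
    Must χ qry (prepend k w) S (w.length + 1) R := by
  induction w generalizing R with
  | nil =>
    refine .skip ?_
    simpa using h
  | cons b w ih =>
    refine must_seq (ih (.push ?_))
    simpa using h

/-- Pop everything from a stack. -/
def clear (k : K) : Prog K := loop false k skip skip

theorem must_clear {k : K} (h : R (Function.update S k [])) :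
    Must χ qry (clear k) S (2 * (S k).length + 1) R := by
  generalize hl : S k = l
  induction l generalizing S with
  | nil =>
    refine .loopNil hl ?_
    rwa [← hl, Function.update_eq_self] at h
  | cons b l ih =>
    refine must_le (.loopCons (t := 1) (R := fun S' => S' = Function.update S k l) hl (by simp) ?_ ?_)
      (?_ : 1 + (2 * l.length + 1) + 1 ≤ _)
    · cases b <;> exact .skip rfl
    · rintro _ rfl
      exact ih (by simpa using h) (by simp)
    · simp; omega

/-- Move the letters of a stack one after the other to another stack. -/
def move (a b : K) : Prog K := loop false a (push b true) (push b false)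

theorem must_move {a b : K} (hab : a ≠ b)
    (h : R (Function.update (Function.update S a []) b ((S a).reverse ++ S b))) :
    Must χ qry (move a b) S (2 * (S a).length + 1) R := by
  generalize hl : S a = l at h
  induction l generalizing S with
  | nil =>
    refine .loopNil hl ?_
    rw [← hl, Function.update_eq_self] at h
    simpa [hl] using h
  | cons c l ih =>
    refine must_le (.loopCons (t := 1) (R := fun S' => S' =
      Function.update (Function.update S a l) b (c :: S b)) hl (by simp) ?_ ?_)
      (?_ : 1 + (2 * l.length + 1) + 1 ≤ _)
    · cases c <;> exact .push (by simp [hab.symm])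
    · rintro _ rfl
      refine ih (by simp [hab]) ?_
      convert h using 1
      funext j
      by_cases h₁ : j = b
      · subst h₁; simp
      · by_cases h₂ : j = a
        · subst h₂; simp [h₁]
        · simp [h₁, h₂]
    · simp; omega

/-- Move the letters of a stack one after the other to two other stacks. -/
def moveTwo (a b c : K) : Prog K :=
  loop false a (seq (push b true) (push c true)) (seq (push b false) (push c false))

theorem must_moveTwo {a b c : K} (hab : a ≠ b) (hac : a ≠ c) (hbc : b ≠ c)
    (h : R (Function.update (Function.update (Function.update S a []) b ((S a).reverse ++ S b)) c
      ((S a).reverse ++ S c))) :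
    Must χ qry (moveTwo a b c) S (3 * (S a).length + 1) R := by
  generalize hl : S a = l at h
  induction l generalizing S with
  | nil =>
    refine .loopNil hl ?_
    rw [← hl, Function.update_eq_self] at h
    simpa [hl] using h
  | cons d l ih =>
    refine must_le (.loopCons (t := 2) (R := fun S' => S' = Function.update
      (Function.update (Function.update S a l) b (d :: S b)) c (d :: S c)) hl (by simp) ?_ ?_)
      (?_ : 2 + (3 * l.length + 1) + 1 ≤ _)
    · cases d <;> exact must_seq (.push (.push (by simp [hab.symm, hac.symm, hbc.symm])))
    · rintro _ rfl
      refine ih (by simp [hab, hac]) ?_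
      convert h using 1
      funext j
      by_cases h₁ : j = c
      · subst h₁; simp
      · by_cases h₂ : j = b
        · subst h₂; simp [h₁]
        · by_cases h₃ : j = a
          · subst h₃; simp [h₁, h₂]
          · simp [h₁, h₂, h₃]
    · simp; omega

/-- Put a copy of the contents of `a` on top of `b`, using the empty stack `tmp`. -/
def copy (tmp a b : K) : Prog K := seq (move a tmp) (moveTwo tmp a b)

/-- Each move reverses the word, so the two reversals cancel and `a` is restored. -/
theorem must_copy {tmp a b : K} (hta : tmp ≠ a) (htb : tmp ≠ b) (hab : a ≠ b) (ht : S tmp = [])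
    (h : R (Function.update S b (S a ++ S b))) :
    Must χ qry (copy tmp a b) S (5 * (S a).length + 2) R := by
  have hm : S a = (Function.update (Function.update S a []) tmp ((S a).reverse ++ S tmp) tmp).reverse := by
    simp [ht]
  have := congrArg List.length hm
  rw [List.length_reverse] at this
  refine must_le (must_seq (must_move hta.symm (must_moveTwo hta htb hab ?_))) (by omega)
  convert h using 1
  funext j
  by_cases h₁ : j = b
  · subst h₁; simp [ht, htb.symm, hab.symm]
  · by_cases h₂ : j = a
    · subst h₂; simp [h₁, ht, hta.symm]
    · by_cases h₃ : j = tmp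
      · subst h₃; simp [h₁, h₂, ht]
      · simp [h₁, h₂, h₃]

/-- The value of a sequence of words and names of stacks. -/
def itemsValue (S : K → List Bool) (l : List (List Bool ⊕ K)) : List Bool :=
  l.flatMap (Sum.elim id S)

/-- Put a sequence of words and of copies of stacks on top of a stack. -/
def emit (tmp k : K) : List (List Bool ⊕ K) → Prog K
  | [] => skip
  | Sum.inl w :: l => seq (emit tmp k l) (prepend k w)
  | Sum.inr a :: l => seq (emit tmp k l) (copy tmp a k)

theorem must_emit {tmp k : K} {l : List (List Bool ⊕ K)} (htk : tmp ≠ k)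
    (hl : ∀ a, Sum.inr a ∈ l → a ≠ k ∧ a ≠ tmp) (ht : S tmp = [])
    (h : R (Function.update S k (itemsValue S l ++ S k))) :
    Must χ qry (emit tmp k l) S (5 * (itemsValue S l).length + 2 * l.length + 1) R := by
  induction l generalizing R with
  | nil =>
    refine .skip ?_
    simpa [itemsValue] using h
  | cons x l ih =>
    have hl' : ∀ a, Sum.inr a ∈ l → a ≠ k ∧ a ≠ tmp := fun a ha => hl a (by simp [ha])
    cases x with
    | inl w =>
      refine must_le (must_seq (ih hl' (must_prepend ?_))) ?_
      · simpa [itemsValue] using h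
      · simp [itemsValue]; omega
    | inr a =>
      obtain ⟨hak, hat⟩ := hl a (by simp)
      refine must_le (must_seq (ih hl' (must_copy hat.symm htk hak ?_ ?_))) ?_
      · simp [htk, ht]
      · simpa [itemsValue, hak] using h
      · simp [itemsValue, hak]; omega

/-- Push a letter `1` on each of a list of stacks. -/
def pushOnes : List K → Prog K
  | [] => skip
  | a :: l => seq (push a true) (pushOnes l)

theorem must_pushOnes {l : List K}
    (h : R fun j => List.replicate (l.count j) true ++ S j) :
    Must χ qry (pushOnes l) S (l.length + 1) R := by
  induction l generalizing S with
  | nil => exact .skip (by simpa using h)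
  | cons a l ih =>
    refine must_le (must_seq (.push (ih ?_))) (by simp; omega)
    convert h using 1
    funext j
    by_cases hj : j = a
    · subst hj
      simp [List.replicate_succ', List.append_assoc]
    · simp [hj, Ne.symm hj]

/-- The number of letters `1` at the start of a string. -/
def ones (l : List Bool) : ℕ := (l.takeWhile id).length

/-- The string that is left after the initial letters `1` and a letter `0`. -/
def afterOnes (l : List Bool) : List Bool := (l.dropWhile id).tail

/-- Read a number in unary and push that many letters `1` on each stack of a list. -/
def scan (k : K) (l : List K) : Prog K := loop true k (pushOnes l) skip

/-- Stated for arbitrary contents through `ones` and `afterOnes`, because queries that encode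
nothing must also be processed within the time bound. -/
theorem must_scan {k : K} {l : List K} (hk : k ∉ l)
    (h : R (Function.update (fun j => List.replicate (ones (S k) * l.count j) true ++ S j) k
      (afterOnes (S k)))) :
    Must χ qry (scan k l) S ((l.length + 2) * ones (S k) + 2) R := by
  generalize hs : S k = s at h
  induction s generalizing S with
  | nil =>
    refine must_le (.loopNil hs ?_) (by omega)
    convert h using 1
    funext j
    by_cases hj : j = k
    · subst hj; simp [hs, afterOnes]
    · simp [hj, ones]
  | cons b s ih =>
    cases b with
    | false =>
      refine must_le (.loopHalt hs (.skip ?_)) (by omega)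
      simpa [ones, afterOnes] using h
    | true =>
      refine must_le (.loopCons (R := fun S' => S' = fun j => List.replicate (l.count j) true ++
        Function.update S k s j) hs (by simp) (must_pushOnes rfl) ?_)
        (?_ : l.length + 1 + ((l.length + 2) * ones s + 2) + 1 ≤ _)
      · rintro _ rfl
        refine ih (by simp [List.count_eq_zero_of_not_mem hk]) ?_
        convert h using 1
        funext j
        by_cases hj : j = k
        · subst hj; simp [afterOnes]
        · simp only [Function.update_of_ne hj, ones, List.takeWhile_cons, id, if_true,
            List.length_cons, Nat.succ_mul, List.replicate_add, List.append_assoc]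
      · simp [ones, Nat.mul_succ]; omega

theorem ones_unary_append (i : ℕ) (l : List Bool) : ones (unary i ++ l) = i := by
  induction i with
  | zero => rfl
  | succ i ih => simp [unary, ones, List.replicate_succ]

theorem afterOnes_unary_append (i : ℕ) (l : List Bool) : afterOnes (unary i ++ l) = l := by
  induction i with
  | zero => rfl
  | succ i ih => simp [unary, afterOnes, List.replicate_succ]

theorem ones_add_length_afterOnes_le (l : List Bool) : ones l + (afterOnes l).length ≤ l.length := by
  have := congrArg List.length (List.takeWhile_append_dropWhile (p := id) (l := l))
  rw [List.length_append] at this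
  simp only [ones, afterOnes, List.length_tail]
  omega

end Prog

end PromiseHierarchy
-- Named stacks for the two reductions
namespace PromiseHierarchy

open Prog

/-- The stacks of the programs for the two reductions. -/
inductive Stk : Type
  | inp | first | second | len | odd | even | form | zero | head | tmp | qry
  deriving DecidableEq

instance : Fintype Stk where
  elems := {.inp, .first, .second, .len, .odd, .even, .form, .zero, .head, .tmp, .qry}
  complete j := by cases j <;> decide

/-- The contents of the stacks. -/
structure Store where
  inp : List Bool := []
  first : List Bool := []
  second : List Bool := []
  len : List Bool := []
  odd : List Bool := []
  even : List Bool := []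
  form : List Bool := []
  zero : List Bool := []
  head : List Bool := []
  tmp : List Bool := []
  qry : List Bool := []

/-- The contents of the stacks as a function. -/
def Store.get (s : Store) : Stk → List Bool
  | .inp => s.inp
  | .first => s.first
  | .second => s.second
  | .len => s.len
  | .odd => s.odd
  | .even => s.even
  | .form => s.form
  | .zero => s.zero
  | .head => s.head
  | .tmp => s.tmp
  | .qry => s.qry

section
variable (s : Store) (l : List Bool)

theorem Store.update_inp : Function.update s.get .inp l = {s with inp := l}.get := by
  funext j; cases j <;> rfl

theorem Store.update_first : Function.update s.get .first l = {s with first := l}.get := by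
  funext j; cases j <;> rfl

theorem Store.update_second : Function.update s.get .second l = {s with second := l}.get := by
  funext j; cases j <;> rfl

theorem Store.update_len : Function.update s.get .len l = {s with len := l}.get := by
  funext j; cases j <;> rfl

theorem Store.update_odd : Function.update s.get .odd l = {s with odd := l}.get := by
  funext j; cases j <;> rfl

theorem Store.update_even : Function.update s.get .even l = {s with even := l}.get := by
  funext j; cases j <;> rfl

theorem Store.update_form : Function.update s.get .form l = {s with form := l}.get := by
  funext j; cases j <;> rfl

theorem Store.update_zero : Function.update s.get .zero l = {s with zero := l}.get := by
  funext j; cases j <;> rfl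

theorem Store.update_head : Function.update s.get .head l = {s with head := l}.get := by
  funext j; cases j <;> rfl

theorem Store.update_tmp : Function.update s.get .tmp l = {s with tmp := l}.get := by
  funext j; cases j <;> rfl

theorem Store.update_qry : Function.update s.get .qry l = {s with qry := l}.get := by
  funext j; cases j <;> rfl

end

theorem Store.init_eq (q : List Bool) :
    Function.update (fun _ => []) Stk.inp q = ({inp := q} : Store).get := by
  funext j; cases j <;> rfl

/-! ### The reduction of `UVAL` to `USAT` -/

section

variable {n : ℕ} (I : Instance n)

/-- The instance whose solutions are those with the first letter `1`. -/
def Instance.withFirst : Instance n where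
  first := I.first
  rest := I.rest
  expr := .and I.expr (.var 0 0)
  first_pos := I.first_pos
  level := I.level
  expr_scoped := ⟨I.expr_scoped, I.first_pos⟩

theorem Instance.encode_withFirst : I.withFirst.encode =
    (I.first :: I.rest).flatMap unary ++
      true :: false :: (I.expr.encode ++ [false, false, false, false]) := by
  simp only [Instance.encode, Instance.withFirst, Expr.encode, unary, List.replicate_zero,
    List.cons_append, List.nil_append]

theorem Instance.mem_solutions_withFirst (x : Fin I.first → Bool) :
    x ∈ solutions I.withFirst.fn ↔ x ∈ solutions I.fn ∧ x ⟨0, I.first_pos⟩ = true := by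
  have h : ∀ e : Expr, CoSat I.rest (e.toFun (I.first :: I.rest) x) ↔
      Alt true I.rest 1 (fun a => e.eval a = true)
        (Function.update (fun _ _ => false) 0 (pad x)) := fun e =>
    ((alt_iff_sat e I.rest 1 (Function.update (fun _ _ => false) 0 (pad x))).2).symm
  refine (h _).trans (Iff.trans ?_ (and_congr_left' (h _).symm))
  rw [Alt.congr (Ψ := fun a => x ⟨0, I.first_pos⟩ = true ∧ I.expr.eval a = true), alt_and_left,
    and_comm]
  · intro a ha
    have : a 0 0 = x ⟨0, I.first_pos⟩ := by
      rw [ha 0 (by omega), Function.update_self, pad_of_lt _ I.first_pos]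
    simp only [Instance.withFirst, Expr.eval, Bool.and_eq_true, this]
    exact and_comm

/-- Exactly one solution of `f` means at most one after the restriction, so the promise of `USAT`
follows from that of `UVAL`. -/
theorem Instance.mem_UVAL_of_withFirst {y : Bool} (hy : y ∈ (USAT n I.withFirst.encode).1) :
    y ∈ uvalAnswers I.first_pos I.fn := by
  rintro ⟨x, hx, huniq⟩
  have hle : (solutions I.withFirst.fn).encard ≤ 1 := by
    rw [Set.encard_le_one_iff]
    intro a b ha hb
    rw [huniq a ((I.mem_solutions_withFirst a).1 ha).1,
      huniq b ((I.mem_solutions_withFirst b).1 hb).1]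
  have h : y = true ↔ ∃ z, z ∈ solutions I.withFirst.fn := by
    refine (hy I.withFirst rfl hle).trans ?_
    rw [Sat]
    rfl
  refine ⟨x, hx, ?_⟩
  show x ⟨0, I.first_pos⟩ = y
  rw [Bool.eq_iff_iff, h]
  refine ⟨fun h₁ => ⟨x, (I.mem_solutions_withFirst x).2 ⟨hx, h₁⟩⟩, fun ⟨z, hz⟩ => ?_⟩
  obtain ⟨h₁, h₂⟩ := (I.mem_solutions_withFirst z).1 hz
  rwa [huniq z h₁] at h₂

end

/-- Move `n` numbers in unary from `inp` to `tmp`. -/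
def copyLengths : ℕ → Prog Stk
  | 0 => skip
  | n + 1 => seq (scan .inp [.tmp]) (seq (push .tmp false) (copyLengths n))

variable {χ : PromiseProblem} {R : (Stk → List Bool) → Prop}

/-- On any input the outcome obeys a length bound; it is known exactly only if the input starts with
`n` codes. The summand `n` in the length bound is for the terminating letters `0`, which are written
even where the input lacks them. -/
theorem must_copyLengths (n : ℕ) (s : Store) (N : ℕ) (hN : s.inp.length ≤ N)
    (h : ∀ i t, i.length + t.length ≤ s.inp.length + s.tmp.length + n →
      (∀ (ms : List ℕ) (e : List Bool), ms.length = n → s.inp = ms.flatMap unary ++ e →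
        i = e ∧ t = (ms.flatMap unary).reverse ++ s.tmp) → R {s with inp := i, tmp := t}.get) :
    Must χ Stk.qry (copyLengths n) s.get (n * (3 * N + 4) + 1) R := by
  induction n generalizing s with
  | zero =>
    refine must_le (.skip (h s.inp s.tmp (by omega) fun ms e hms he => ?_)) (by omega)
    obtain rfl := List.length_eq_zero_iff.1 hms
    exact ⟨by simpa using he, by simp⟩
  | succ n ih =>
    have h₁ := ones_add_length_afterOnes_le s.inp
    refine must_le (must_seq (must_scan (by simp) (must_seq (.push ?_))))
      (?_ : 3 * ones s.inp + 2 + (1 + (n * (3 * N + 4) + 1)) ≤ _)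
    · have : ∀ S : Stk → List Bool, S = {s with
          inp := afterOnes s.inp
          tmp := false :: (List.replicate (ones s.inp) true ++ s.tmp)}.get →
          Must χ Stk.qry (copyLengths n) S (n * (3 * N + 4) + 1) R := by
        rintro _ rfl
        refine ih _ (le_trans (by simp only; omega) hN) fun i t hit hval => ?_
        simp only [List.length_cons, List.length_append, List.length_replicate] at hit
        refine h i t (by omega) fun ms e hms he => ?_
        cases ms with
        | nil => simp at hms
        | cons m ms =>
          rw [List.flatMap_cons, List.append_assoc] at he
          have := hval ms e (by simpa using hms) (by simp only [he, afterOnes_unary_append])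
          rw [he, ones_unary_append] at this
          refine ⟨this.1, ?_⟩
          rw [this.2]
          simp [unary]
      refine this _ ?_
      funext j
      cases j <;> simp [Store.get]
    · rw [Nat.add_one_mul n]
      omega

/-- Call the oracle and move the answer to `inp`. -/
def answer : Prog Stk := seq call (cases .qry skip (push .inp true) (push .inp false))

theorem must_answer {s : Store}
    (h : ∀ y ∈ (χ s.qry).1, R {s with inp := y :: s.inp, qry := []}.get) :
    Must χ .qry answer s.get 3 R := by
  refine must_seq (u := 2) (.call fun y hy => .casesCons (b := y) (l := [])
    (by rw [Function.update_self]) ?_)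
  rw [Store.update_qry, Store.update_qry]
  cases y <;> exact .push (by rw [Store.update_inp]; exact h _ hy)

/-- The program that answers a query for `UVAL` with the help of `USAT`. -/
def uvalProg (n : ℕ) : Prog Stk :=
  seq (copyLengths n) (seq (prepend .tmp [false, true]) (seq (move .inp .tmp)
    (seq (prepend .tmp [false, false, false, false]) (seq (move .tmp .qry) answer))))

theorem uvalProg_computes (n : ℕ) : (uvalProg n).Computes .inp .qry (UVAL n) (USAT n) := by
  refine ⟨Polynomial.C n * (3 * Polynomial.X + 4) + 4 * Polynomial.X +
    Polynomial.C (4 * n) + 100, fun q => ?_⟩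
  rw [Store.init_eq]
  refine must_le (must_seq (u := 4 * q.length + 4 * n + 50)
    (must_copyLengths n _ q.length le_rfl fun i t hit hval => ?_)) ?_
  -- The query is assembled in reverse on `tmp`: `[false, true]` is the reversed tag of `and`, and
  -- the four letters `0` that follow the old expression are the code of `var 0 0`.
  · refine must_le (must_seq (must_prepend ?_)) (?_ : 3 + (4 * q.length + 4 * n + 47) ≤ _)
    · simp only [Store.update_tmp, Store.get]
      refine must_le (must_seq (must_move (by decide) ?_))
        (?_ : (2 * i.length + 1) + (5 + (2 * (i.length + t.length + 6) + 1 + 3)) ≤ _)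
      · simp only [Store.update_inp, Store.update_tmp, Store.get]
        refine must_seq (must_prepend ?_)
        simp only [Store.update_tmp, Store.get]
        refine must_le (must_seq (must_move (by decide) ?_)) (?_ : _ + 3 ≤ _)
        · simp only [Store.update_tmp, Store.update_qry, Store.get]
          refine must_answer fun y hy => ⟨y, ?_, ?_⟩
          · rintro I rfl
            obtain ⟨rfl, ht⟩ := hval (I.first :: I.rest) I.expr.encode I.level rfl
            refine I.mem_UVAL_of_withFirst ?_
            rw [I.encode_withFirst]
            simpa only [Store.get, ht, List.reverse_append, List.reverse_reverse,
              List.reverse_cons, List.reverse_nil, List.append_nil, List.nil_append,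
              List.append_assoc, List.cons_append] using hy
          · rw [Store.init_eq]
        · simp [Store.get]; omega
      · simp only [List.length_nil] at hit
        omega
    · omega
  · simp
    omega

theorem uval_weakClosure_subset (n : ℕ) : weakClosure (UVAL n) ⊆ UDeltaSucc n :=
  fun _ h => TuringReducible.of_computes (uvalProg_computes n) h

end PromiseHierarchy
namespace PromiseHierarchy

open Prog

/-! ### The program for the reduction of `USAT` to `UVAL`: renaming of variables -/

/-- Read a variable (without its tag); return its codes after the two renamings and the string that
is left. -/
def readVar (m : ℕ) : List Bool → (List Bool × List Bool) × List Bool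
  | true :: true :: l =>
    ((false :: false :: true :: (List.replicate (ones l) true ++ false :: true ::
        (List.replicate (ones (afterOnes l) * 2) true ++ [false])),
      false :: false :: true :: true :: (List.replicate (ones l) true ++ false ::
        (List.replicate (ones (afterOnes l) * 2) true ++ [false]))), afterOnes (afterOnes l))
  | true :: l =>
    ((false :: false :: false :: true :: true ::
        (List.replicate m true ++ (List.replicate (ones l.tail) true ++ [false])),
      false :: false :: true :: false :: (List.replicate (ones l.tail * 2) true ++ [false])),
      afterOnes l.tail)
  | l =>
    ((false :: false :: false :: true :: true :: (List.replicate (ones l.tail) true ++ [false]),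
      false :: false :: false :: true :: true :: (List.replicate (ones l.tail) true ++ [false])),
      afterOnes l.tail)

/-- A potential estimate with weight 8 for each unread letter. The `16` pays for the two letters of
the tag, which have been read already, and `m` for the shift past `x`. -/
theorem length_readVar_le (m : ℕ) (l : List Bool) :
    (readVar m l).1.1.length + 8 * (readVar m l).2.length ≤ 8 * l.length + m + 16 ∧
      (readVar m l).1.2.length + 8 * (readVar m l).2.length ≤ 8 * l.length + m + 16 ∧
        (readVar m l).2.length ≤ l.length := by
  match l with
  | true :: true :: l =>
    have h₁ := ones_add_length_afterOnes_le l
    have h₂ := ones_add_length_afterOnes_le (afterOnes l)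
    simp [readVar]
    omega
  | true :: [] => simp [readVar, ones, afterOnes]; omega
  | true :: false :: l =>
    have h₁ := ones_add_length_afterOnes_le l
    simp [readVar]
    omega
  | [] => simp [readVar, ones, afterOnes]
  | false :: l =>
    have h₁ := ones_add_length_afterOnes_le l
    simp [readVar]
    omega

/-- Apply the two renamings of variables to a code of an expression. -/
def renameCode (m : ℕ) : List Bool → List Bool × List Bool
  | [] => ([], [])
  | [b] => ([b], [b])
  | false :: false :: l =>
    ((readVar m l).1.1 ++ (renameCode m (readVar m l).2).1,
      (readVar m l).1.2 ++ (renameCode m (readVar m l).2).2)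
  | false :: true :: l =>
    (false :: true :: (renameCode m l).1, false :: true :: (renameCode m l).2)
  | true :: b :: l => (true :: b :: (renameCode m l).1, true :: b :: (renameCode m l).2)
termination_by l => l.length
decreasing_by
  all_goals
    first
    | exact Nat.lt_of_le_of_lt (length_readVar_le _ _).2.2 (by simp only [List.length_cons]; omega)
    | (simp only [List.length_cons]; omega)

theorem length_renameCode_le (m : ℕ) (l : List Bool) :
    (renameCode m l).1.length ≤ (m + 8) * l.length ∧
      (renameCode m l).2.length ≤ (m + 8) * l.length := by
  induction l using renameCode.induct (m := m) with
  | case1 => simp [renameCode]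
  | case2 b => simp [renameCode]
  | case3 l ih =>
    obtain ⟨h₁, h₂, h₃⟩ := length_readVar_le m l
    have h₄ := Nat.mul_le_mul_left m h₃
    simp only [renameCode, List.length_append, List.length_cons, Nat.add_mul, Nat.mul_add] at *
    omega
  | case4 l ih =>
    simp only [renameCode, List.length_cons, Nat.add_mul, Nat.mul_add] at *
    omega
  | case5 b l ih =>
    simp only [renameCode, List.length_cons, Nat.add_mul, Nat.mul_add] at *
    omega

/-- In prefix notation a renaming of variables acts on one symbol at a time, so a single pass from
left to right suffices and no parsing is needed. -/
theorem renameCode_encode_append (m : ℕ) (e : Expr) (l : List Bool) :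
    renameCode m (e.encode ++ l) =
      ((e.rename (oddRenaming m)).encode ++ (renameCode m l).1,
        (e.rename evenRenaming).encode ++ (renameCode m l).2) := by
  induction e generalizing l with
  | var i j =>
    have h : readVar m (unary i ++ (unary j ++ l)) =
        (((Expr.rename (oddRenaming m) (.var i j)).encode,
          (Expr.rename evenRenaming (.var i j)).encode), l) := by
      have hs : ∀ i : ℕ, unary (i + 1) = true :: unary i := fun i => by
        simp [unary, List.replicate_succ]
      have h₀ : ∀ (i : ℕ) (l : List Bool), List.replicate i true ++ (false :: l) = unary i ++ l :=
        fun i l => by simp [unary]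
      match i with
      | 0 =>
        have : unary 0 ++ (unary j ++ l) = false :: (unary j ++ l) := rfl
        simp [this, readVar, Expr.rename, Expr.encode, oddRenaming, evenRenaming,
          ones_unary_append, afterOnes_unary_append, Nat.add_comm 2 j, hs]
        simp [unary]
      | 1 =>
        have : unary 1 ++ (unary j ++ l) = true :: false :: (unary j ++ l) := rfl
        rw [this]
        simp only [readVar, Expr.rename, Expr.encode, oddRenaming, evenRenaming, List.tail_cons,
          ones_unary_append, afterOnes_unary_append, Nat.add_assoc 2 m j, Nat.add_comm 2 (m + j), hs]
        simp [unary, Nat.mul_comm, ← List.replicate_append_replicate]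
      | i + 2 =>
        simp [hs, readVar, Expr.rename, Expr.encode, oddRenaming, evenRenaming,
          ones_unary_append, afterOnes_unary_append]
        simp [unary, Nat.mul_comm]
    simp only [Expr.encode, List.append_assoc, List.cons_append, List.nil_append, renameCode]
    rw [h]
  | not e ih => simp [Expr.encode, Expr.rename, renameCode, ih]
  | and e₁ e₂ ih₁ ih₂ => simp [Expr.encode, Expr.rename, renameCode, ih₁, ih₂]
  | or e₁ e₂ ih₁ ih₂ => simp [Expr.encode, Expr.rename, renameCode, ih₁, ih₂]

variable {χ : PromiseProblem} {R : (Stk → List Bool) → Prop}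

theorem must_scan_inp {l : List Stk} (hl : Stk.inp ∉ l) {s s' : Store}
    (hs : s' = ⟨afterOnes s.inp, List.replicate (ones s.inp * l.count Stk.first) true ++ s.first,
      List.replicate (ones s.inp * l.count Stk.second) true ++ s.second,
      List.replicate (ones s.inp * l.count Stk.len) true ++ s.len,
      List.replicate (ones s.inp * l.count Stk.odd) true ++ s.odd,
      List.replicate (ones s.inp * l.count Stk.even) true ++ s.even,
      List.replicate (ones s.inp * l.count Stk.form) true ++ s.form,
      List.replicate (ones s.inp * l.count Stk.zero) true ++ s.zero,
      List.replicate (ones s.inp * l.count Stk.head) true ++ s.head,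
      List.replicate (ones s.inp * l.count Stk.tmp) true ++ s.tmp,
      List.replicate (ones s.inp * l.count Stk.qry) true ++ s.qry⟩)
    (h : R s'.get) :
    Must χ Stk.qry (scan .inp l) s.get ((l.length + 2) * ones s.inp + 2) R := by
  refine must_scan hl ?_
  convert h using 1
  subst hs
  funext j
  cases j <;> simp [Store.get]

/-- Push a letter on the stacks `odd` and `even`. -/
def pushBoth (b : Bool) : Prog Stk := seq (push .odd b) (push .even b)

theorem must_pushBoth {b : Bool} {s : Store}
    (h : R {s with odd := b :: s.odd, even := b :: s.even}.get) :
    Must χ Stk.qry (pushBoth b) s.get 2 R := by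
  unfold pushBoth
  refine must_seq (u := 1) (.push ?_)
  simp only [Store.get, Store.update_odd]
  refine .push ?_
  simpa only [Store.get, Store.update_even] using h

/-- Continue to read a variable of the first argument. -/
def readFirstProg : Prog Stk :=
  seq (pushBoth false) (seq (pushBoth true) (seq (pushBoth true)
    (seq (scan .inp [.odd, .even]) (pushBoth false))))

theorem must_readFirstProg {s : Store}
    (h : R {s with
      inp := afterOnes s.inp
      odd := false :: (List.replicate (ones s.inp) true ++ true :: true :: false :: s.odd)
      even := false :: (List.replicate (ones s.inp) true ++ true :: true :: false :: s.even)}.get) :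
    Must χ Stk.qry readFirstProg s.get (4 * s.inp.length + 12) R := by
  have hle := ones_add_length_afterOnes_le s.inp
  refine must_le (must_seq (must_pushBoth (must_seq (must_pushBoth (must_seq (must_pushBoth
    (must_seq (must_scan_inp (by decide) rfl (must_pushBoth ?_)))))))))
    (?_ : 2 + (2 + (2 + (4 * ones s.inp + 2 + 2))) ≤ _)
  · simpa using h
  · omega

/-- Continue to read a variable of the second argument. -/
def readSecondProg : Prog Stk :=
  seq (prepend .odd [true, true, false]) (seq (prepend .even [false, true])
    (seq (copy .tmp .first .odd) (seq (scan .inp [.odd, .even, .even]) (pushBoth false))))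

theorem must_readSecondProg {s : Store} (ht : s.tmp = [])
    (h : R {s with
      inp := afterOnes s.inp
      odd := false :: (List.replicate (ones s.inp) true ++
        (s.first ++ true :: true :: false :: s.odd))
      even := false :: (List.replicate (ones s.inp * 2) true ++ false :: true :: s.even)}.get) :
    Must χ Stk.qry readSecondProg s.get (5 * s.inp.length + 5 * s.first.length + 20) R := by
  have hle := ones_add_length_afterOnes_le s.inp
  refine must_le (must_seq (must_prepend ?_))
    (?_ : 4 + (3 + (5 * s.first.length + 2 + (5 * ones s.inp + 2 + 2))) ≤ _)
  · simp only [Store.update_odd]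
    refine must_seq (must_prepend ?_)
    simp only [Store.update_even]
    refine must_seq (must_copy (by decide) (by decide) (by decide) ht ?_)
    simp only [Store.update_odd]
    refine must_seq (must_scan_inp (by decide) rfl (must_pushBoth ?_))
    simpa [Store.get] using h
  · omega

/-- Continue to read a variable of a later argument. -/
def readLaterProg : Prog Stk :=
  seq (pushBoth true) (seq (push .even true) (seq (scan .inp [.odd, .even])
    (seq (pushBoth false) (seq (push .odd true)
      (seq (scan .inp [.odd, .odd, .even, .even]) (pushBoth false))))))

theorem must_readLaterProg {s : Store}
    (h : R {s with
      inp := afterOnes (afterOnes s.inp)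
      odd := false :: (List.replicate (ones (afterOnes s.inp) * 2) true ++
        true :: false :: (List.replicate (ones s.inp) true ++ true :: s.odd))
      even := false :: (List.replicate (ones (afterOnes s.inp) * 2) true ++
        false :: (List.replicate (ones s.inp) true ++ true :: true :: s.even))}.get) :
    Must χ Stk.qry readLaterProg s.get (10 * s.inp.length + 20) R := by
  have h₁ := ones_add_length_afterOnes_le s.inp
  have h₂ := ones_add_length_afterOnes_le (afterOnes s.inp)
  refine must_le (must_seq (must_pushBoth (must_seq (.push ?_))))
    (?_ : 2 + (1 + (4 * ones s.inp + 2 + (2 + (1 + (6 * ones (afterOnes s.inp) + 2 + 2))))) ≤ _)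
  · simp only [Store.update_even]
    refine must_seq (must_scan_inp (by decide) rfl (must_seq (must_pushBoth (must_seq (.push ?_)))))
    simp only [Store.update_odd]
    refine must_seq (must_scan_inp (by decide) rfl (must_pushBoth ?_))
    simpa [Store.get] using h
  · omega

/-- Read a variable and write its codes after the two renamings. -/
def readVarProg : Prog Stk :=
  seq (pushBoth false) (seq (pushBoth false) (cases .inp readFirstProg
    (cases .inp readSecondProg readLaterProg readSecondProg) readFirstProg))

theorem must_readVarProg {s : Store} {m : ℕ} (hm : s.first = List.replicate m true)
    (ht : s.tmp = [])
    (h : R {s with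
      inp := (readVar m s.inp).2
      odd := (readVar m s.inp).1.1.reverse ++ s.odd
      even := (readVar m s.inp).1.2.reverse ++ s.even}.get) :
    Must χ Stk.qry readVarProg s.get (10 * s.inp.length + 5 * m + 40) R := by
  refine must_le (must_seq (must_pushBoth (must_seq (must_pushBoth ?_))))
    (?_ : 2 + (2 + (10 * s.inp.length + 5 * m + 30)) ≤ _)
  swap
  · omega
  obtain ⟨inp, first, second, len, odd, even, form, zero, head, tmp, qry⟩ := s
  simp only at hm ht h ⊢
  subst hm ht
  rcases inp with _ | ⟨_ | _, l⟩
  · refine must_le (.casesNil rfl (must_readFirstProg ?_)) (by simp)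
    simpa [readVar] using h
  · refine must_le (.casesCons rfl ?_) (?_ : (4 * l.length + 12) + 1 ≤ _)
    · simp only [Store.update_inp]
      refine must_readFirstProg ?_
      simpa [readVar] using h
    · simp; omega
  · rcases l with _ | ⟨_ | _, l⟩
    · refine must_le (.casesCons rfl ?_) (?_ : (5 * m + 21) + 1 ≤ _)
      · simp only [Store.update_inp]
        refine must_le (.casesNil rfl (must_readSecondProg rfl ?_)) (by simp)
        simpa [readVar, -List.replicate_append_replicate] using h
      · simp; omega
    · refine must_le (.casesCons rfl ?_) (?_ : (5 * l.length + 5 * m + 21) + 1 ≤ _)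
      · simp only [Store.update_inp]
        refine must_le (.casesCons rfl ?_) (?_ : (5 * l.length + 5 * m + 20) + 1 ≤ _)
        · simp only [Store.update_inp]
          refine must_le (must_readSecondProg rfl ?_) (by simp)
          simpa [readVar, -List.replicate_append_replicate] using h
        · omega
      · simp; omega
    · refine must_le (.casesCons rfl ?_) (?_ : (10 * l.length + 21) + 1 ≤ _)
      · simp only [Store.update_inp]
        refine .casesCons rfl ?_
        simp only [Store.update_inp]
        refine must_readLaterProg ?_
        simpa [readVar] using h
      · simp; omega

/-- Apply the two renamings of variables to the code on the stack `inp`. -/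
def renameProg : Prog Stk :=
  loop false .inp
    (seq (pushBoth true) (cases .inp skip (pushBoth true) (pushBoth false)))
    (cases .inp (pushBoth false) (seq (pushBoth false) (pushBoth true)) readVarProg)

/-- A round reads one symbol, hence at least one letter but an unknown number of them; this is why
the induction on the length is strong. The constant `c` bounds the cost of a round. -/
theorem must_renameProg {s : Store} {m N : ℕ} (hm : s.first = List.replicate m true)
    (ht : s.tmp = []) (hN : s.inp.length ≤ N)
    (h : R {s with
      inp := []
      odd := (renameCode m s.inp).1.reverse ++ s.odd
      even := (renameCode m s.inp).2.reverse ++ s.even}.get) :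
    Must χ Stk.qry renameProg s.get (s.inp.length * (10 * N + 5 * m + 50) + 1) R := by
  generalize hc : 10 * N + 5 * m + 50 = c
  generalize hn : s.inp.length = n
  induction n using Nat.strong_induction_on generalizing s with
  | _ n ih =>
    have hloop : ∀ s' : Store, s'.inp.length < n → s'.first = List.replicate m true → s'.tmp = [] →
        R {s' with
          inp := []
          odd := (renameCode m s'.inp).1.reverse ++ s'.odd
          even := (renameCode m s'.inp).2.reverse ++ s'.even}.get →
        Must χ Stk.qry renameProg s'.get ((n - 1) * c + 1) R := fun s' h₁ h₂ h₃ h₄ =>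
      must_le (ih _ h₁ h₂ h₃ (by omega) h₄ rfl)
        (Nat.add_le_add_right (Nat.mul_le_mul_right c (by omega)) 1)
    have hle : 1 ≤ n → (c - 1) + ((n - 1) * c + 1) + 1 ≤ n * c + 1 := by
      intro h
      obtain ⟨n, rfl⟩ : ∃ k, n = k + 1 := ⟨n - 1, by omega⟩
      rw [Nat.add_sub_cancel, Nat.add_one_mul n]
      omega
    obtain ⟨inp, first, second, len, odd, even, form, zero, head, tmp, qry⟩ := s
    simp only at hm ht hN hn h ⊢
    subst hm ht
    rcases inp with _ | ⟨_ | _, l⟩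
    · refine must_le (.loopNil rfl ?_) (by omega)
      simpa [renameCode] using h
    · refine must_le (.loopCons (t := c - 1) (R := fun S => Must χ Stk.qry renameProg S
        ((n - 1) * c + 1) R) rfl rfl ?_ fun _ => id) (hle (by simp at hn; omega))
      simp only [Store.update_inp]
      rcases l with _ | ⟨_ | _, l⟩
      · refine must_le (.casesNil rfl (must_pushBoth (hloop _ ?_ rfl rfl ?_))) (by omega)
        · simp at hn ⊢; omega
        · simpa [renameCode] using h
      · refine must_le (.casesCons rfl ?_)
          (?_ : (10 * l.length + 5 * m + 40) + 1 ≤ _)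
        · simp only [Store.update_inp]
          refine must_readVarProg rfl rfl (hloop _ ?_ rfl rfl ?_)
          · have := (length_readVar_le m l).2.2
            simp at hn ⊢; omega
          · simpa [renameCode] using h
        · simp at hN; omega
      · refine must_le (.casesCons rfl ?_) (?_ : 4 + 1 ≤ _)
        · simp only [Store.update_inp]
          refine must_seq (must_pushBoth (must_pushBoth (hloop _ ?_ rfl rfl ?_)))
          · simp at hn ⊢; omega
          · simpa [renameCode] using h
        · omega
    · refine must_le (.loopCons (t := c - 1) (R := fun S => Must χ Stk.qry renameProg S
        ((n - 1) * c + 1) R) rfl rfl ?_ fun _ => id) (hle (by simp at hn; omega))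
      simp only [Store.update_inp]
      refine must_le (must_seq (must_pushBoth ?_)) (?_ : 2 + 3 ≤ _)
      · rcases l with _ | ⟨_ | _, l⟩
        · refine must_le (.casesNil rfl (.skip (hloop _ ?_ rfl rfl ?_))) (by omega)
          · simp at hn ⊢; omega
          · simpa [renameCode] using h
        all_goals
          refine .casesCons rfl ?_
          simp only [Store.update_inp]
          refine must_pushBoth (hloop _ ?_ rfl rfl ?_)
          · simp at hn ⊢; omega
          · simpa [renameCode] using h
      · omega

end PromiseHierarchy
namespace PromiseHierarchy

open Prog

/-! ### The program for the reduction of `USAT` to `UVAL`: lengths and formula -/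

variable {χ : PromiseProblem} {R : (Stk → List Bool) → Prop}

/-- Read `k` numbers in unary and push twice their sum on the stack `len`. -/
def skipLengths : ℕ → Prog Stk
  | 0 => skip
  | k + 1 => seq (scan .inp [.len, .len]) (skipLengths k)

theorem must_skipLengths (k : ℕ) {s : Store} {N l : ℕ} (hN : s.inp.length ≤ N)
    (hl : s.len = List.replicate l true)
    (h : ∀ i l', l' + 2 * i.length ≤ l + 2 * s.inp.length → i.length ≤ s.inp.length →
      (∀ (ms : List ℕ) (e : List Bool), ms.length = k → s.inp = ms.flatMap unary ++ e →
        i = e ∧ l' = l + 2 * ms.sum) → R {s with inp := i, len := List.replicate l' true}.get) :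
    Must χ Stk.qry (skipLengths k) s.get (k * (4 * N + 4) + 1) R := by
  induction k generalizing s l with
  | zero =>
    refine must_le (.skip ?_) (by omega)
    have := h s.inp l le_rfl le_rfl fun ms e hms he => by
      obtain rfl := List.length_eq_zero_iff.1 hms
      exact ⟨by simpa using he, by simp⟩
    rwa [← hl] at this
  | succ k ih =>
    have h₁ := ones_add_length_afterOnes_le s.inp
    refine must_le (must_seq (must_scan_inp (by decide) rfl (ih (l := ones s.inp * 2 + l)
      (le_trans ?_ hN) ?_ fun i l' hil hi hval => ?_)))
      (?_ : 4 * ones s.inp + 2 + (k * (4 * N + 4) + 1) ≤ _)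
    · simp only; omega
    · simp [hl]
    · simp only at hil hi hval
      have := h i l' (by omega) (by omega) fun ms e hms he => by
        cases ms with
        | nil => simp at hms
        | cons m ms =>
          rw [List.flatMap_cons, List.append_assoc] at he
          have := hval ms e (by simpa using hms) (by simp only [he, afterOnes_unary_append])
          rw [he, ones_unary_append] at this
          refine ⟨this.1, ?_⟩
          rw [this.2, List.sum_cons]
          omega
      simpa using this
    · rw [Nat.add_one_mul k]
      omega

/-- Read `k + 1` numbers in unary. -/
def readLengths (k : ℕ) : Prog Stk :=
  seq (scan .inp [.first]) (match k with
    | 0 => skip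
    | k + 1 => seq (scan .inp [.second, .len, .len]) (skipLengths k))

/-- At level 1 nothing is put on `second`, in accordance with the default `0` of `ms.headD 0`. -/
theorem must_readLengths (k : ℕ) (q : List Bool)
    (h : ∀ i m₁ m₂ l, i.length + m₁ + m₂ ≤ q.length → l ≤ 2 * q.length →
      (∀ (m : ℕ) (ms : List ℕ) (e : List Bool), ms.length = k →
        q = (m :: ms).flatMap unary ++ e →
          i = e ∧ m₁ = m ∧ m₂ = ms.headD 0 ∧ l = 2 * ms.sum) →
      R (Store.get {
        inp := i
        first := List.replicate m₁ true
        second := List.replicate m₂ true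
        len := List.replicate l true })) :
    Must χ Stk.qry (readLengths k) (Store.get {inp := q})
      (8 * q.length + 10 + k * (4 * q.length + 4)) R := by
  have h₁ := ones_add_length_afterOnes_le q
  have h₂ := ones_add_length_afterOnes_le (afterOnes q)
  have hq : ∀ (m : ℕ) (ms : List ℕ) (e : List Bool), q = (m :: ms).flatMap unary ++ e →
      ones q = m ∧ afterOnes q = ms.flatMap unary ++ e := fun m ms e he => by
    rw [List.flatMap_cons, List.append_assoc] at he
    rw [he, ones_unary_append, afterOnes_unary_append]
    exact ⟨rfl, rfl⟩
  cases k with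
  | zero =>
    refine must_le (must_seq (must_scan_inp (by decide) rfl (.skip ?_))) (?_ : 3 * ones q + 2 + 1 ≤ _)
    · have := h (afterOnes q) (ones q) 0 0 (by omega) (by omega) fun m ms e hms he => by
        obtain rfl := List.length_eq_zero_iff.1 hms
        obtain ⟨h₃, h₄⟩ := hq m [] e he
        exact ⟨by simpa using h₄, h₃, rfl, rfl⟩
      simpa using this
    · omega
  | succ k =>
    refine must_le (must_seq (must_scan_inp (by decide) rfl (must_seq (must_scan_inp (by decide) rfl
      (must_skipLengths k (N := q.length) (l := ones (afterOnes q) * 2) (by simp only; omega)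
        (by simp) fun i l hil hi hval => ?_)))))
      (?_ : 3 * ones q + 2 + (5 * ones (afterOnes q) + 2 + (k * (4 * q.length + 4) + 1)) ≤ _)
    · simp only at hil hi hval
      have := h i (ones q) (ones (afterOnes q)) l (by omega) (by omega) fun m ms e hms he => by
        cases ms with
        | nil => simp at hms
        | cons m' ms =>
          obtain ⟨h₃, h₄⟩ := hq m _ e he
          rw [List.flatMap_cons, List.append_assoc] at h₄
          rw [h₄, afterOnes_unary_append, ones_unary_append] at hval
          have := hval ms e (by simpa using hms) rfl
          rw [h₄, ones_unary_append]
          refine ⟨this.1, h₃, rfl, ?_⟩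
          rw [this.2, List.sum_cons]
          omega
      simpa using this
    · rw [Nat.add_one_mul k]
      omega

/-- The lengths of the arguments of the new formula. -/
def headItems (k : ℕ) : List (List Bool ⊕ Stk) :=
  [.inl [true, true], .inr .first, .inr .second, .inl [false]] ++
    (List.replicate k [.inr .len, .inl [false]]).flatten

theorem itemsValue_headItems (k : ℕ) {s : Store} {m₁ m₂ l : ℕ}
    (h₁ : s.first = List.replicate m₁ true) (h₂ : s.second = List.replicate m₂ true)
    (h₃ : s.len = List.replicate l true) :
    itemsValue s.get (headItems k) =
      ((2 + m₁ + m₂) :: List.replicate k l).flatMap unary := by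
  have h : (List.replicate k ([.inr .len, .inl [false]] : List (List Bool ⊕ Stk))).flatten.flatMap
      (Sum.elim id s.get) = (List.replicate k l).flatMap unary := by
    induction k with
    | zero => rfl
    | succ k ih => simp [List.replicate_succ, ih, Store.get, h₃, unary]
  simp only [itemsValue, headItems, List.flatMap_append, h]
  simp [Store.get, h₁, h₂, unary, ← List.replicate_append_replicate]

theorem length_flatMap_unary (ms : List ℕ) : (ms.flatMap unary).length = ms.sum + ms.length := by
  induction ms with
  | nil => rfl
  | cons m ms ih => simp [unary, ih]; omega

theorem length_headItems (k : ℕ) : (headItems k).length = 4 + 2 * k := by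
  induction k with
  | zero => rfl
  | succ k ih =>
    simp [headItems, List.replicate_succ] at ih ⊢
    omega

/-- The code of the step from `geIter m₁ j` to `geIter m₁ (j + 1)`. -/
def geStep (m₁ j : ℕ) : List Bool :=
  [true, true, true, false] ++ (Expr.var 1 (2 * j)).encode ++
    [false, true] ++ (Expr.var 0 (2 + m₁ + j)).encode ++
    [true, false, true, true] ++ (Expr.var 1 (2 * j)).encode ++
    [false, true] ++ (Expr.var 0 (2 + m₁ + j)).encode

/-- The code of the step from `zeroIter m₁ j` to `zeroIter m₁ (j + 1)`. -/
def zeroStep (m₁ j : ℕ) : List Bool :=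
  [true, false, true, true, false, true, false, false, false, true, false, false, true] ++
    (Expr.var 0 (2 + m₁ + j)).encode

/-- The concatenation of `f 0, …, f (m - 1)`. -/
def concatUpTo (f : ℕ → List Bool) : ℕ → List Bool
  | 0 => []
  | m + 1 => concatUpTo f m ++ f m

theorem length_concatUpTo_le {f : ℕ → List Bool} {m b : ℕ} (h : ∀ j < m, (f j).length ≤ b) :
    (concatUpTo f m).length ≤ m * b := by
  induction m with
  | zero => simp [concatUpTo]
  | succ m ih =>
    have h₁ := ih fun j hj => h j (by omega)
    have h₂ := h m (by omega)
    rw [concatUpTo, List.length_append, Nat.add_one_mul m]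
    omega

/-- `geIter` wraps its argument, so its code is a prefix followed by the code of `e`; a program can
write it by pushing words on top of the code already there. -/
theorem encode_geIter (m₁ m : ℕ) (e : Expr) :
    (e.geIter m₁ m).encode = concatUpTo (geStep m₁) m ++ e.encode := by
  induction m generalizing e with
  | zero => rfl
  | succ m ih =>
    rw [Expr.geIter, ih, concatUpTo]
    simp only [Expr.encode, geStep, List.append_assoc, List.cons_append, List.nil_append]

theorem encode_zeroIter (m₁ m : ℕ) (e : Expr) :
    (e.zeroIter m₁ m).encode = concatUpTo (zeroStep m₁) m ++ e.encode := by
  induction m generalizing e with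
  | zero => rfl
  | succ m ih =>
    rw [Expr.zeroIter, ih, concatUpTo]
    simp [Expr.encode, zeroStep, unary]

/-- The variable for a letter of `y`. -/
def yItems : List (List Bool ⊕ Stk) :=
  [.inl [false, false, false, true, true], .inr .first, .inr .second, .inl [false]]

/-- The variable for a letter of `z`. -/
def zItems : List (List Bool ⊕ Stk) :=
  [.inl [false, false, true, false], .inr .second, .inr .second, .inl [false]]

theorem itemsValue_append {K : Type} (S : K → List Bool) (l l' : List (List Bool ⊕ K)) :
    itemsValue S (l ++ l') = itemsValue S l ++ itemsValue S l' := List.flatMap_append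

theorem itemsValue_yItems {s : Store} {m₁ j : ℕ} (h₁ : s.first = List.replicate m₁ true)
    (h₂ : s.second = List.replicate j true) :
    itemsValue s.get yItems = (Expr.var 0 (2 + m₁ + j)).encode := by
  simp [itemsValue, yItems, Store.get, h₁, h₂, Expr.encode, unary,
    ← List.replicate_append_replicate]

theorem itemsValue_zItems {s : Store} {j : ℕ} (h₂ : s.second = List.replicate j true) :
    itemsValue s.get zItems = (Expr.var 1 (2 * j)).encode := by
  simp [itemsValue, zItems, Store.get, h₂, Expr.encode, unary, Nat.two_mul,
    ← List.replicate_append_replicate]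

/-- The step of `geIter`. -/
def geItems : List (List Bool ⊕ Stk) :=
  [.inl [true, true, true, false]] ++ zItems ++ [.inl [false, true]] ++ yItems ++
    [.inl [true, false, true, true]] ++ zItems ++ [.inl [false, true]] ++ yItems

/-- The step of `zeroIter`. -/
def zeroItems : List (List Bool ⊕ Stk) :=
  [.inl [true, false, true, true, false, true, false, false, false, true, false, false, true]] ++
    yItems

theorem length_encode_var (i j : ℕ) : (Expr.var i j).encode.length = i + j + 4 := by
  simp [Expr.encode, unary]
  omega

theorem length_geStep (m₁ j : ℕ) : (geStep m₁ j).length = 2 * m₁ + 6 * j + 34 := by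
  simp only [geStep, List.length_append, length_encode_var, List.length_cons, List.length_nil]
  omega

theorem length_zeroStep (m₁ j : ℕ) : (zeroStep m₁ j).length = m₁ + j + 19 := by
  simp only [zeroStep, List.length_append, length_encode_var, List.length_cons, List.length_nil]
  omega

/-- Write the steps of `geIter` and `zeroIter`. -/
def stepsProg : Prog Stk :=
  loop false .second (seq (emit .tmp .form geItems) (emit .tmp .zero zeroItems)) skip

/-- The loop counter `second` doubles as the index: after the pop it holds `j` letters, which
`yItems` and `zItems` copy into the variables. Counting down puts step `0` on top, as `concatUpTo`
requires. -/
theorem must_stepsProg {s : Store} {m₁ m N : ℕ} (h₁ : s.first = List.replicate m₁ true)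
    (h₂ : s.second = List.replicate m true) (ht : s.tmp = []) (hN : m₁ + m ≤ N)
    (h : R {s with
      second := []
      form := concatUpTo (geStep m₁) m ++ s.form
      zero := concatUpTo (zeroStep m₁) m ++ s.zero}.get) :
    Must χ Stk.qry stepsProg s.get (m * (40 * N + 400) + 1) R := by
  induction m generalizing s with
  | zero =>
    refine must_le (.loopNil h₂ ?_) (by omega)
    have h₃ : s.second = [] := h₂
    obtain ⟨inp, first, second, len, odd, even, form, zero, head, tmp, qry⟩ := s
    simp only at h₃
    subst h₃
    exact h
  | succ m ih =>
    obtain ⟨inp, first, second, len, odd, even, form, zero, head, tmp, qry⟩ := s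
    simp only at h₁ h₂ ht h
    subst h₁ h₂ ht
    refine must_le (.loopCons (b := true) (l := List.replicate m true) (t := 35 * N + 350)
      (R := fun S => Must χ Stk.qry stepsProg S (m * (40 * N + 400) + 1) R) rfl rfl ?_ fun _ => id) ?_
    · simp only [Store.update_second]
      set s' : Store := ⟨inp, List.replicate m₁ true, List.replicate m true, len, odd, even, form,
        zero, head, [], qry⟩ with hs'
      have hge : itemsValue s'.get geItems = geStep m₁ m := by
        simp only [geItems, itemsValue_append, itemsValue_zItems (s := s') (j := m) rfl,
          itemsValue_yItems (s := s') (m₁ := m₁) (j := m) rfl rfl, geStep]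
        rfl
      have hz : itemsValue (Store.get {s' with form := geStep m₁ m ++ form}) zeroItems =
          zeroStep m₁ m := by
        simp only [zeroItems, itemsValue_append, zeroStep, itemsValue_yItems
          (s := {s' with form := geStep m₁ m ++ form}) (m₁ := m₁) (j := m) rfl rfl]
        rfl
      refine must_le (must_seq (u := 5 * (m₁ + m + 19) + 11) (must_emit (by decide)
        (by simp [geItems, yItems, zItems]) rfl ?_)) ?_
      · rw [hge, Store.update_form]
        refine must_le (must_emit (by decide) (by simp [zeroItems, yItems]) rfl ?_) ?_
        · simp only [Store.get, hs'] at hz ⊢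
          rw [hz, Store.update_zero]
          refine ih rfl rfl rfl (by omega) ?_
          simpa [concatUpTo] using h
        · simp only [Store.get, hs'] at hz ⊢
          rw [hz, length_zeroStep]
          simp [zeroItems, yItems]
      · rw [hge, length_geStep]
        simp [geItems, yItems, zItems]
        omega
    · rw [Nat.add_one_mul m]
      omega

end PromiseHierarchy
namespace PromiseHierarchy

open Prog

/-! ### The program for the reduction of `USAT` to `UVAL`: search -/

variable {χ : PromiseProblem} {R : (Stk → List Bool) → Prop}

/-- Write the formula `core`. -/
def formProg : Prog Stk :=
  seq (move .odd .form) (seq (prepend .form [true, true, false, false, false, true, false, false, true])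
    (seq (move .even .form) (seq (prepend .form [false, true, false, false, false, true, false])
      (seq stepsProg (seq (prepend .form
        [true, false, true, true, true, false, false, true, false, false, false, true, false])
          (seq (copy .tmp .zero .form) (clear .zero)))))))

/-- The code of `core`, given the codes of the renamed formulas. -/
def coreCode (m₁ m₂ : ℕ) (A B : List Bool) : List Bool :=
  concatUpTo (zeroStep m₁) m₂ ++
    ([true, false, true, true, true, false, false, true, false, false, false, true, false] ++
      (concatUpTo (geStep m₁) m₂ ++ ([false, true, false, false, false, true, false] ++
        (B ++ ([true, true, false, false, false, true, false, false, true] ++ A)))))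

theorem encode_core (m₁ m₂ : ℕ) (f : Expr) : (f.core m₁ m₂).encode =
    coreCode m₁ m₂ (f.rename (oddRenaming m₁)).encode (f.rename evenRenaming).encode := by
  rw [Expr.core, encode_zeroIter]
  simp [Expr.encode, encode_geIter, coreCode, unary]

/-- The formula is written from its end. The counter `second` is used up in one loop, so the steps
of `zeroIter`, which belong in front of a later prefix, wait on the stack `zero`. -/
theorem must_formProg {m₁ m₂ N : ℕ} {A B len head : List Bool} (hN : m₁ + m₂ ≤ N)
    (hA : A.length ≤ N * N + 8 * N) (hB : B.length ≤ N * N + 8 * N)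
    (h : (coreCode m₁ m₂ A B).length ≤ 9 * (N * N) + 69 * N + 30 → R (Store.get {
      first := List.replicate m₁ true
      len := len
      form := coreCode m₁ m₂ A B
      head := head})) :
    Must χ Stk.qry formProg (Store.get {
      first := List.replicate m₁ true
      second := List.replicate m₂ true
      len := len
      odd := A.reverse
      even := B.reverse
      head := head}) (60 * (N * N) + 600 * N + 100) R := by
  have hge : (concatUpTo (geStep m₁) m₂).length ≤ N * (6 * N + 34) :=
    (length_concatUpTo_le (b := 6 * N + 34) fun j hj => by rw [length_geStep]; omega).trans
      (Nat.mul_le_mul_right _ (by omega))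
  have hz : (concatUpTo (zeroStep m₁) m₂).length ≤ N * (N + 19) :=
    (length_concatUpTo_le (b := N + 19) fun j hj => by rw [length_zeroStep]; omega).trans
      (Nat.mul_le_mul_right _ (by omega))
  have hm : m₂ * (40 * N + 400) ≤ N * (40 * N + 400) := Nat.mul_le_mul_right _ (by omega)
  have e₁ : N * (6 * N + 34) = 6 * (N * N) + 34 * N := by ring
  have e₂ : N * (N + 19) = N * N + 19 * N := by ring
  have e₃ : N * (40 * N + 400) = 40 * (N * N) + 400 * N := by ring
  refine must_le (must_seq (must_move (by decide) ?_)) (?_ : (2 * A.reverse.length + 1) + (10 +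
    ((2 * B.reverse.length + 1) + (8 + (m₂ * (40 * N + 400) + 1 + (14 +
      (5 * (concatUpTo (zeroStep m₁) m₂).length + 2 +
        (2 * (concatUpTo (zeroStep m₁) m₂).length + 1))))))) ≤ _)
  swap
  · simp only [List.length_reverse]
    omega
  simp only [Store.update_form, Store.update_odd, Store.get]
  refine must_seq (must_prepend ?_)
  simp only [Store.update_form, Store.get]
  refine must_seq (must_move (by decide) ?_)
  simp only [Store.update_form, Store.update_even, Store.get]
  refine must_seq (must_prepend ?_)
  simp only [Store.update_form, Store.get]
  refine must_seq (must_stepsProg rfl rfl rfl hN ?_)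
  refine must_seq (must_prepend ?_)
  simp only [Store.update_form, Store.get, List.append_nil, List.reverse_reverse]
  refine must_seq (must_copy (by decide) (by decide) (by decide) rfl ?_)
  simp only [Store.update_form, Store.get]
  refine must_clear ?_
  simp only [Store.update_zero]
  refine h ?_
  simp only [coreCode, List.length_append, List.length_cons, List.length_nil]
  omega

/-- Compute the lengths and the formula `core` of an instance of level `k + 1`. -/
def setupProg (k : ℕ) : Prog Stk :=
  seq (readLengths k) (seq (emit .tmp .head (headItems k)) (seq renameProg formProg))

theorem must_setupProg (k : ℕ) (q : List Bool)
    (h : ∀ m₁ l fs hs, m₁ ≤ q.length → l ≤ 2 * q.length →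
      fs.length ≤ 9 * (q.length * q.length) + 69 * q.length + 30 →
      hs.length ≤ q.length + 3 + k * (2 * q.length + 1) →
      (∀ I : Instance (k + 1), I.encode = q → m₁ = I.first ∧
        fs = (I.expr.core I.first I.second).encode ∧
        hs = (liftLengths I.first I.rest).flatMap unary) →
      R (Store.get {
        first := List.replicate m₁ true
        len := List.replicate l true
        form := fs
        head := hs})) :
    Must χ Stk.qry (setupProg k) (Store.get {inp := q})
      (75 * (q.length * q.length) + 700 * q.length + 200 + k * (20 * q.length + 20)) R := by
  generalize hN : q.length = N at h ⊢
  refine must_le (must_seq (u := 5 * (N + 3 + k * (2 * N + 1)) + 2 * (4 + 2 * k) + 1 +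
    (N * (15 * N + 50) + 1 + (60 * (N * N) + 600 * N + 100)))
    (must_readLengths k q fun i m₁ m₂ l him hl hval => ?_)) ?_
  · rw [hN] at him hl
    have hhv : itemsValue (Store.get {
        inp := i
        first := List.replicate m₁ true
        second := List.replicate m₂ true
        len := List.replicate l true }) (headItems k) = _ :=
      itemsValue_headItems k (m₁ := m₁) (m₂ := m₂) (l := l) rfl rfl rfl
    have hhl : (((2 + m₁ + m₂) :: List.replicate k l).flatMap unary).length ≤
        N + 3 + k * (2 * N + 1) := by
      have := Nat.mul_le_mul_left k hl
      simp only [length_flatMap_unary, List.sum_cons, List.sum_replicate, List.length_cons,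
        List.length_replicate, smul_eq_mul, Nat.mul_add, Nat.mul_one]
      omega
    refine must_seq (must_le (must_emit (by decide) ?_ rfl ?_) ?_)
    · intro a ha
      have : a = .first ∨ a = .second ∨ a = .len := by
        simp only [headItems, List.mem_append, List.mem_flatten, List.mem_replicate] at ha
        rcases ha with ha | ⟨_, ⟨_, rfl⟩, ha⟩ <;> simp at ha <;> tauto
      rcases this with rfl | rfl | rfl <;> decide
    · rw [hhv, Store.update_head]
      simp only [Store.get, List.append_nil]
      refine must_seq (must_le (must_renameProg (m := m₁) (N := N) rfl rfl (by simp only; omega) ?_) ?_)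
      · have hr := length_renameCode_le m₁ i
        have hr' : (m₁ + 8) * i.length ≤ N * N + 8 * N := by
          have := Nat.mul_le_mul (show m₁ + 8 ≤ N + 8 by omega) (show i.length ≤ N by omega)
          rwa [Nat.add_mul N 8 N] at this
        simp only [List.append_nil]
        refine must_formProg (N := N) (by omega) (hr.1.trans hr') (hr.2.trans hr') fun hf => ?_
        refine h m₁ l _ _ (by omega) hl hf (by simpa using hhl) ?_
        rintro I rfl
        obtain ⟨rfl, rfl, rfl, rfl⟩ := hval I.first I.rest I.expr.encode (by
          have := I.level
          omega) rfl
        have hren := renameCode_encode_append I.first I.expr []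
        rw [List.append_nil] at hren
        refine ⟨rfl, ?_, ?_⟩
        · rw [encode_core, hren]
          simp [renameCode]
        · have hk : I.rest.length = k := by
            have := I.level
            omega
          simp [liftLengths, hk]
      · have := Nat.mul_le_mul (show i.length ≤ N by omega)
          (show 10 * N + 5 * m₁ + 50 ≤ 15 * N + 50 by omega)
        simp only
        omega
    · rw [hhv, length_headItems]
      omega
  · rw [hN]
    have e₁ : N * (15 * N + 50) = 15 * (N * N) + 50 * N := by ring
    have e₂ : k * (2 * N + 1) = 2 * (k * N) + k := by ring
    have e₃ : k * (4 * N + 4) = 4 * (k * N) + 4 * k := by ring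
    have e₄ : k * (20 * N + 20) = 20 * (k * N) + 20 * k := by ring
    omega

end PromiseHierarchy
namespace PromiseHierarchy

open Prog

variable {χ : PromiseProblem} {R : (Stk → List Bool) → Prop}

theorem Instance.encode_lift {n : ℕ} (I : Instance n) (E : Expr)
    (hE : E.Scoped (liftLengths I.first I.rest)) :
    (I.lift E hE).encode = (liftLengths I.first I.rest).flatMap unary ++ E.encode := rfl

/-- Call the oracle and continue according to the answer. -/
def ask (p q : Prog Stk) : Prog Stk := seq call (cases .qry skip p q)

theorem must_ask {s : Store} {p q : Prog Stk} {t : ℕ}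
    (h : ∀ y ∈ (χ s.qry).1, Must χ .qry (branch p q y) {s with qry := []}.get t R) :
    Must χ .qry (ask p q) s.get (t + 2) R := by
  refine must_le (must_seq (u := t + 1) (.call fun y hy => .casesCons (b := y) (l := [])
    (by rw [Function.update_self]) ?_)) (by omega)
  rw [Store.update_qry, Store.update_qry]
  exact h y hy

/-- The code of `searchQuery` before the code of the formula. -/
def searchItems : List (List Bool ⊕ Stk) :=
  [.inl [true, false, true, false, false, false, false, true, false, true, true, true, false,
      false, false, false, false, false, false, false, true, true], .inr .first,
    .inl [false, true, false, false, true, false, false, false, false, false, true,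
      false, false, false, true, true], .inr .first, .inl [false]]

/-- The code of `literal` before the code of the formula. -/
def literalItems : Bool → List (List Bool ⊕ Stk)
  | true => [.inl [true, false, false, false, false, true, true], .inr .first, .inl [false]]
  | false => [.inl [true, false, false, true, false, false, false, true, true], .inr .first,
      .inl [false]]

/-- Find a letter of the solution. -/
def searchStep : Prog Stk :=
  seq (copy .tmp .form .qry) (seq (emit .tmp .qry searchItems) (seq (copy .tmp .head .qry)
    (ask (emit .tmp .form (literalItems true)) (emit .tmp .form (literalItems false)))))

theorem encode_searchQuery {s : Store} {j : ℕ} (hs : s.first = List.replicate j true) (G : Expr) :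
    (Expr.searchQuery j G).encode = itemsValue s.get searchItems ++ G.encode := by
  simp [Expr.searchQuery, Expr.iff, Expr.encode, unary, searchItems, itemsValue, Store.get, hs,
    Nat.add_comm 2 j, List.replicate_succ]

theorem encode_literal_and {s : Store} {j : ℕ} (hs : s.first = List.replicate j true) (y : Bool)
    (G : Expr) :
    (Expr.and (.literal j y) G).encode = itemsValue s.get (literalItems y) ++ G.encode := by
  cases y <;> simp [Expr.literal, Expr.encode, unary, literalItems, itemsValue, Store.get, hs,
    Nat.add_comm 2 j, List.replicate_succ]

/-- Running time and growth of the formula hold for every oracle and all contents; only the claim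
about `IsPartial` presupposes that the stacks describe an instance and that the oracle is `UVAL`. -/
theorem must_searchStep {j : ℕ} {l fs hs : List Bool}
    (h : ∀ y w, w.length ≤ j + 10 →
      (∀ (n : ℕ) (I : Instance n) (c : ℕ → Bool) (G : Expr), j < I.first → I.IsPartial c (j + 1) G →
        fs = G.encode → hs = (liftLengths I.first I.rest).flatMap unary → χ = UVAL n →
          I.IsPartial (Function.update c j y) j (.and (.literal j y) G) ∧
          w ++ fs = (Expr.and (.literal j y) G).encode) →
      R (Store.get {first := List.replicate j true, len := l, form := w ++ fs, head := hs})) :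
    Must χ Stk.qry searchStep
      (Store.get {first := List.replicate j true, len := l, form := fs, head := hs})
      (5 * fs.length + 5 * hs.length + 15 * j + 300) R := by
  have hlen : ∀ s : Store, s.first = List.replicate j true →
      (itemsValue s.get searchItems).length = 39 + 2 * j ∧
      ∀ y, (itemsValue s.get (literalItems y)).length ≤ 10 + j := fun s hs => by
    refine ⟨?_, fun y => ?_⟩
    · simp [searchItems, itemsValue, Store.get, hs]
      omega
    · cases y <;> simp [literalItems, itemsValue, Store.get, hs] <;> omega
  refine must_le (must_seq (must_copy (by decide) (by decide) (by decide) rfl ?_))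
    (?_ : 5 * fs.length + 2 + (5 * (39 + 2 * j) + 11 + (5 * hs.length + 2 + (5 * (10 + j) + 7 + 2))) ≤ _)
  · simp only [Store.update_qry, Store.get]
    refine must_seq (must_le (must_emit (by decide) (by simp [searchItems]) rfl ?_)
      (by rw [(hlen _ rfl).1]; simp [searchItems]))
    simp only [Store.update_qry]
    simp only [show ∀ s : Store, s.get .qry = s.qry from fun _ => rfl, List.append_nil]
    refine must_seq (must_copy (by decide) (by decide) (by decide) rfl ?_)
    simp only [Store.update_qry]
    simp only [show ∀ s : Store, s.get .qry = s.qry from fun _ => rfl,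
      show ∀ s : Store, s.get .head = s.head from fun _ => rfl]
    refine must_ask fun y hy => ?_
    simp only at hy
    have := must_emit (χ := χ) (qry := Stk.qry) (R := R) (tmp := Stk.tmp) (k := .form)
      (l := literalItems y) (S := Store.get
      {first := List.replicate j true, len := l, form := fs, head := hs}) (by decide)
      (by cases y <;> simp [literalItems]) rfl ?_
    · refine must_le (u := 5 * (10 + j) + 7) (t := 5 * (itemsValue (Store.get
        {first := List.replicate j true, len := l, form := fs, head := hs})
          (literalItems y)).length + 2 * (literalItems y).length + 1) ?_ ?_
      · cases y <;> exact this
      · have := (hlen {first := List.replicate j true, len := l, form := fs, head := hs} rfl).2 y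
        have h' : (literalItems y).length = 3 := by cases y <;> rfl
        omega
    · rw [Store.update_form]
      refine h y _ (((hlen _ rfl).2 y).trans (by omega)) ?_
      rintro n I c G hj hG rfl rfl rfl
      refine ⟨hG.literal hj ?_, (encode_literal_and rfl y G).symm⟩
      rw [I.encode_lift, encode_searchQuery (s := {
        first := List.replicate j true, len := l, form := G.encode, qry := G.encode,
        head := (liftLengths I.first I.rest).flatMap unary}) rfl]
      exact hy
  · omega

/-- Find the solution. -/
def searchProg : Prog Stk := loop false .first searchStep skip

/-- The round with counter `j < i` lengthens the formula by at most `j + 10` letters, so `B` bounds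
its length throughout. -/
theorem must_searchProg {n i B : ℕ} {q l fs hs : List Bool}
    (hI : ∀ I : Instance n, I.encode = q → hs = (liftLengths I.first I.rest).flatMap unary ∧
      i ≤ I.first ∧ ∃ c G, I.IsPartial c i G ∧ fs = G.encode)
    (hB : fs.length + i * (i + 10) ≤ B)
    (h : ∀ fs, fs.length ≤ B → (∀ I : Instance n, I.encode = q →
        hs = (liftLengths I.first I.rest).flatMap unary ∧
        ∃ c G, I.IsPartial c 0 G ∧ fs = G.encode) →
      R (Store.get {len := l, form := fs, head := hs})) :
    Must (UVAL n) Stk.qry searchProg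
      (Store.get {first := List.replicate i true, len := l, form := fs, head := hs})
      (i * (5 * B + 5 * hs.length + 15 * i + 301) + 1) R := by
  induction i generalizing fs with
  | zero =>
    refine must_le (.loopNil rfl (h fs (by omega) fun I hq => ?_)) (by omega)
    exact ⟨(hI I hq).1, (hI I hq).2.2⟩
  | succ j ih =>
    have e₁ : (j + 1) * (j + 1 + 10) = j * (j + 10) + 2 * j + 11 := by ring
    have e₂ : (j + 1) * (5 * B + 5 * hs.length + 15 * (j + 1) + 301) =
      j * (5 * B + 5 * hs.length + 15 * j + 301) + 15 * j +
        (5 * B + 5 * hs.length + 15 * (j + 1) + 301) := by ring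
    refine must_le (.loopCons (b := true) (l := List.replicate j true)
      (t := 5 * fs.length + 5 * hs.length + 15 * j + 300)
      (u := j * (5 * B + 5 * hs.length + 15 * j + 301) + 1)
      (R := fun S => Must (UVAL n) Stk.qry searchProg S
        (j * (5 * B + 5 * hs.length + 15 * j + 301) + 1) R) rfl rfl ?_ fun _ => id) ?_
    · rw [Store.update_first]
      refine must_searchStep fun y w hw hval => ih (fun I hq => ?_) ?_
      · obtain ⟨h₁, h₂, c, G, h₃, h₄⟩ := hI I hq
        exact ⟨h₁, by omega, _, _, hval n I c G h₂ h₃ h₄ h₁ rfl⟩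
      · simp only [List.length_append] at hB ⊢
        omega
    · omega

/-- Ask whether the string found is a solution. -/
def finalProg : Prog Stk :=
  seq (copy .tmp .form .qry) (seq (prepend .qry [true, false, true, true, true, false,
      false, false, false, false, false, false, false, true, false,
      true, false, false, true, false, false, false, false, false, true, false, false, false, true,
        false])
    (seq (copy .tmp .head .qry) (seq answer (seq (clear .form) (seq (clear .head) (clear .len))))))

/-- All stacks but `inp` are emptied at the end, since `Prog.Computes` demands this for the sake of
later calls. -/
theorem must_finalProg {l fs hs : List Bool}
    (h : ∀ y, (∀ (n : ℕ) (I : Instance n) (c : ℕ → Bool) (G : Expr), I.IsPartial c 0 G →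
        fs = G.encode → hs = (liftLengths I.first I.rest).flatMap unary → χ = UVAL n →
          y ∈ usatAnswers I.fn) →
      R (Store.get {inp := [y]})) :
    Must χ Stk.qry finalProg (Store.get {len := l, form := fs, head := hs})
      (7 * fs.length + 7 * hs.length + 2 * l.length + 50) R := by
  refine must_le (must_seq (must_copy (by decide) (by decide) (by decide) rfl ?_))
    (?_ : 5 * fs.length + 2 + (31 + (5 * hs.length + 2 + (3 +
      (2 * fs.length + 1 + (2 * hs.length + 1 + (2 * l.length + 1)))))) ≤ _)
  · simp only [Store.update_qry, Store.get]
    refine must_seq (must_prepend ?_)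
    simp only [Store.update_qry, Store.get]
    refine must_seq (must_copy (by decide) (by decide) (by decide) rfl ?_)
    simp only [Store.update_qry, Store.get]
    refine must_seq (must_answer fun y hy => ?_)
    refine must_seq (must_clear ?_)
    simp only [Store.update_form]
    refine must_seq (must_clear ?_)
    simp only [Store.update_head]
    refine must_clear ?_
    simp only [Store.update_len]
    refine h y ?_
    rintro n I c G hG rfl rfl rfl
    refine hG.mem_USAT ?_
    rw [I.encode_lift]
    simpa [Expr.finalQuery, Expr.iff, Expr.encode, unary] using hy
  · omega

/-- The program that answers a query for `USAT` of level `k + 1` with the help of `UVAL`. -/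
def usatProg (k : ℕ) : Prog Stk := seq (setupProg k) (seq searchProg finalProg)

open Polynomial in
theorem usatProg_computes (k : ℕ) :
    (usatProg k).Computes .inp .qry (USAT (k + 1)) (UVAL (k + 1)) := by
  -- In the factor `N + 2`, `N` stands for the rounds of the search and `2` covers the final query.
  have key : ∀ N m l B B' f g g' : ℕ, m ≤ N → l ≤ 2 * N → f ≤ B → B ≤ B' → g ≤ g' →
      m * (5 * B + 5 * g + 15 * m + 301) + 1 + (7 * f + 7 * g + 2 * l + 50) ≤
      (N + 2) * (5 * B' + 5 * g' + 15 * N + 301) := by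
    intro N m l B B' f g g' hm hl hf hB hg
    obtain ⟨T, hT⟩ : ∃ T, T = 5 * B' + 5 * g' + 15 * N + 301 := ⟨_, rfl⟩
    obtain ⟨U, hU⟩ : ∃ U, U = 5 * B + 5 * g + 15 * m + 301 := ⟨_, rfl⟩
    rw [← hT, ← hU, Nat.add_mul N 2]
    have h₁ : m * U ≤ N * T := Nat.mul_le_mul hm (by omega)
    omega
  refine ⟨(75 * (X * X) + 700 * X + 200 + C k * (20 * X + 20)) +
    (X + 2) * (5 * (10 * (X * X) + 79 * X + 30) + 5 * (X + 3 + C k * (2 * X + 1)) + 15 * X + 301),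
    fun q => ?_⟩
  rw [Store.init_eq]
  refine must_le (must_seq (u := (q.length + 2) *
    (5 * (10 * (q.length * q.length) + 79 * q.length + 30) +
      5 * (q.length + 3 + k * (2 * q.length + 1)) + 15 * q.length + 301))
    (must_setupProg k q fun m l fs hs hm hl hf hh hval => ?_)) ?_
  · have hmm : m * (m + 10) ≤ q.length * q.length + 10 * q.length := by
      have := Nat.mul_le_mul hm (Nat.add_le_add_right hm 10)
      rwa [Nat.mul_add q.length, Nat.mul_comm q.length 10] at this
    refine must_le (must_seq (u := 7 * (fs.length + m * (m + 10)) + 7 * hs.length + 2 * l + 50)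
      (must_searchProg (n := k + 1) (q := q) (B := fs.length + m * (m + 10))
        (fun I hq => ?_) le_rfl fun fs' hf' hI => ?_)) (key _ _ _ _ _ _ _ _ hm hl le_rfl (by omega) hh)
    · obtain ⟨rfl, h₁, h₂⟩ := hval I hq
      exact ⟨h₂, le_rfl, _, _, I.isPartial_core, h₁⟩
    · refine must_le (must_finalProg fun y hy => ⟨y, fun I hq => ?_, ?_⟩) ?_
      · obtain ⟨h₁, c, G, h₂, h₃⟩ := hI I hq
        exact hy _ I c G h₂ h₃ h₁ rfl
      · rw [Store.init_eq]
      · rw [List.length_replicate]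
        omega
  · simp

theorem usat_weakClosure_subset (k : ℕ) : UDeltaSucc (k + 1) ⊆ weakClosure (UVAL (k + 1)) :=
  fun _ h => TuringReducible.of_computes (usatProg_computes k) h

end PromiseHierarchy

theorem theorem12 (n : ℕ) (hn : 1 ≤ n) :
    PromiseHierarchy.weakClosure (PromiseHierarchy.UVAL n) =
      PromiseHierarchy.UDeltaSucc n := by
  obtain ⟨k, rfl⟩ := Nat.exists_eq_add_of_le' hn
  exact (PromiseHierarchy.uval_weakClosure_subset _).antisymm
    (PromiseHierarchy.usat_weakClosure_subset k)
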